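/- Let $(\theta_m)_{m\ge1}$ be non-negative reals, let $r,\vartheta>0$ and $K\in\mathbb{R}$, and suppose that $g_\Theta(t)=\sum_{m\ge1}\frac{\theta_m}{m}t^m$ belongs to $\mathcal F(r,\vartheta,K)$. This means that, for some $R>r$ and $0<\phi<\pi/2$, $g_\Theta$ is (extends to) a holomorphic function on $\Delta_0=\{z\in\mathbb{C}: |z|<R,\ z\ne r,\ |\arg(z-r)|>\phi\}$ with $$g_\Theta(t)=\vartheta\log\Big(\frac1{1-t/r}\Big)+K+O(t-r)\qquad(t\to r,\ t\in\Delta_0).$$ For each $n$ let $A_n\subset\{1,\dots,n\}$ and $D_n=\{1,\dots,n\}\setminus A_n$. Set $d_n=\max D_n$ if $D_n\neq\emptyset$ and $d_n=1$ otherwise, and assume that $C\log n-\frac{n}{d_n}\to-\infty$ as $n\to\infty$ for every $C\in\mathbb{R}$. Put $L_{D_n}(r)=\sum_{m\in D_n}\frac{\theta_m}{m}r^m$. Let $\mathbb{P}_\Theta^{(A_n)}$ be the measure on the symmetric group $\mathfrak S_n$ given by $$\mathbb{P}_\Theta^{(A_n)}[\sigma]=\frac1{h_n\,n!}\prod_{i=1}^{\ell(\lambda)}\theta_{\lambda_i}\mathbf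 1_{\{\lambda_i\in A_n\}},$$ where $\lambda=(\lambda_1,\dots,\lambda_{\ell(\lambda)})$ is the cycle-type of $\sigma$ (fixed points included) and $h_n$ is the normalization constant. Let $T_n$ be the total number of cycles of $\sigma$. Then, under $\mathbb{P}_\Theta^{(A_n)}$, the sequence $(T_n)$ converges in the strong mod-Poisson sense with parameters $\lambda_n=K+\vartheta\log n-L_{D_n}(r)$ and limiting function $\Gamma(\vartheta)/\Gamma(\vartheta e^{is})$ (read as $0$ where $\vartheta e^{is}$ is a pole of $\Gamma$). That is, for all large $n$ the measure $\mathbb{P}_\Theta^{(A_n)}$ is a well-defined probability measure and $\lambda_n>0$, and $$\exp\big(\lambda_n(1-e^{is})\big)\,\mathbb{E}_\Theta^{(A_n)}\big[e^{isT_n}\big]\ \longrightarrow\ \frac{\Gamma(\vartheta)}{\Gamma(\vartheta e^{is})}\qquad(n\to\infty)$$ locally uniformly in $s\in\mathbb{R}$. -/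

import Mathlib

open Filter Topology MeasureTheory Asymptotics

namespace WeightedPerm

/-- The slit disc `Δ₀(r, R, φ)`. -/
def Delta (r R φ : ℝ) : Set ℂ :=
  {z : ℂ | ‖z‖ < R ∧ z ≠ (r : ℂ) ∧ φ < |Complex.arg (z - r)|}

/-- The class `𝓕(r, ϑ, K)`: functions holomorphic in some `Δ₀(r, R, φ)` with `R > r` and
`0 < φ < π / 2`, having there a logarithmic singularity of weight `ϑ` at `r`. -/
def ClassF (r ϑ K : ℝ) : Set (ℂ → ℂ) :=
  {g | ∃ R φ : ℝ, r < R ∧ 0 < φ ∧ φ < Real.pi / 2 ∧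
    DifferentiableOn ℂ g (Delta r R φ) ∧
    (fun t : ℂ => g t - ((ϑ : ℂ) * Complex.log (1 / (1 - t / r)) + K))
      =O[𝓝[Delta r R φ] (r : ℂ)] (fun t : ℂ => t - r)}

/-- The power series `g_Θ(t) = ∑_{m ≥ 1} (θ_m / m) t ^ m` belongs to `𝓕(r, ϑ, K)`, i.e. it is the
expansion at `0` of a function of that class (`0` lies in the domain `Δ₀(r, R, φ)`, which is
star-shaped about `0`, so this function is unique there). -/
def GenFunInClassF (θ : ℕ → ℝ) (r ϑ K : ℝ) : Prop :=
  ∃ g ∈ ClassF r ϑ K, ∀ᶠ t : ℂ in 𝓝 0,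
    HasSum (fun m : ℕ => ((θ (m + 1) : ℂ) / ((m + 1 : ℕ) : ℂ)) * t ^ (m + 1)) (g t)

/-- The polynomial `L_D(t) = ∑_{m ∈ D} (θ_m / m) t ^ m` for a finite set `D`. -/
noncomputable def L (θ : ℕ → ℝ) (D : Finset ℕ) (t : ℝ) : ℝ :=
  ∑ m ∈ D, θ m / m * t ^ m

/-- The set `{1, …, n} \ A` of forbidden cycle lengths. -/
def forbidden (n : ℕ) (A : Finset ℕ) : Finset ℕ :=
  Finset.Icc 1 n \ A

/-- The largest element of `D`, and `1` if `D` is empty. -/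
def maxOrOne (D : Finset ℕ) : ℕ :=
  if h : D.Nonempty then D.max' h else 1

/-- The cycle-type of a permutation as a multiset of cycle lengths, fixed points included. -/
def cycleLengths {n : ℕ} (σ : Equiv.Perm (Fin n)) : Multiset ℕ :=
  σ.partition.parts

/-- `C_m`, the number of cycles of length `m`. -/
def cycleCount {n : ℕ} (m : ℕ) (σ : Equiv.Perm (Fin n)) : ℕ :=
  (cycleLengths σ).count m

/-- `T_n`, the total number of cycles. -/
def totalCycles {n : ℕ} (σ : Equiv.Perm (Fin n)) : ℕ :=
  ∑ m ∈ Finset.Icc 1 n, cycleCount m σ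

/-- The unnormalised weight `∏_i θ_{λ_i} 1_{λ_i ∈ A}`. -/
def weight (θ : ℕ → ℝ) (A : Finset ℕ) {n : ℕ} (σ : Equiv.Perm (Fin n)) : ℝ :=
  ((cycleLengths σ).map (fun l => if l ∈ A then θ l else 0)).prod

/-- The normalisation constant `h_n(A)`. -/
noncomputable def h (θ : ℕ → ℝ) (n : ℕ) (A : Finset ℕ) : ℝ :=
  (1 / (n.factorial : ℝ)) * ∑ σ : Equiv.Perm (Fin n), weight θ A σ

instance instMeasurableSpacePerm (n : ℕ) : MeasurableSpace (Equiv.Perm (Fin n)) := ⊤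

/-- The `A`-weighted measure on the symmetric group; it is a probability measure as soon as
`h_n(A) > 0`. -/
noncomputable def weightedMeasure (θ : ℕ → ℝ) (n : ℕ) (A : Finset ℕ) :
    Measure (Equiv.Perm (Fin n)) :=
  ∑ σ : Equiv.Perm (Fin n),
    ENNReal.ofReal (1 / (h θ n A * n.factorial) * weight θ A σ) • Measure.dirac σ

/-- Strong mod-Poisson convergence of the real random variables `Z n`, defined on `(Ω n, P n)`
(for all large `n`), with parameters `lam n` and limiting function `Φ`: the quotient of the
characteristic function of `Z n` by that of a Poisson variable of parameter `lam n` converges to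
`Φ`, locally uniformly on the real line. -/
structure StrongModPoisson {Ω : ℕ → Type*} [∀ n, MeasurableSpace (Ω n)]
    (P : ∀ n, Measure (Ω n)) (Z : ∀ n, Ω n → ℝ) (lam : ℕ → ℝ) (Φ : ℝ → ℂ) : Prop where
  isProbabilityMeasure : ∀ᶠ n in atTop, IsProbabilityMeasure (P n)
  aemeasurable : ∀ᶠ n in atTop, AEMeasurable (Z n) (P n)
  parameter_pos : ∀ᶠ n in atTop, 0 < lam n
  tendsto : TendstoLocallyUniformly
    (fun (n : ℕ) (s : ℝ) =>
      Complex.exp ((lam n : ℂ) * (1 - Complex.exp (Complex.I * s))) *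
        ∫ ω, Complex.exp (Complex.I * s * (Z n ω : ℂ)) ∂(P n))
    Φ atTop

end WeightedPerm

/-! Put a_m = θ_m r^m, G(t) = g(rt), P_D(t) = ∑_{m ∈ D} a_m t^m / m and S = P_D(1). By the
exponential formula, r^n (1/n!) ∑_σ weight(σ) w^{T(σ)} is the n-th Taylor coefficient of exp(w (G -
P_D)). Near t = 1 this function resembles exp(w (K - S)) (1 - t)^{-wϑ}. With λ_n = K + ϑ log n - S,
the n-th coefficient of that model times n e^{-wλ_n} tends to 1/Γ(wϑ), uniformly for |w| = 1
(`tendstoUniformlyOn_normNegBinom`). If the coefficient of the difference is negligible at this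
scale, dividing the limit at w = e^{is} by the limit at w = 1 leaves e^{λ_n (1 - w)} E[w^{T_n}] →
Γ(ϑ)/Γ(ϑw).

The difficulty is that P_D changes with n and has degree up to d = d_n, so the singularity analysis
must be uniform in D. This is `LogSingular.exists_taylorCoeff_remainder_le`. In Cauchy's formula put
t = e^v and let v run along a ray at angle φ from -1/n until |t| = e^{c/d}, then along that circle;
the lower half is the mirror image. As c ≤ 1, the powers t^m with m ≤ d stay bounded by e. On the
ray the relative error is O(d |t - 1|), which contributes O(d/n). On the circle everything is at
most a power of n, against the factor e^{-cn/d}; the hypothesis on d_n makes this vanish.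

Two bounds on the weights enter: ∑_{m ≤ d} a_m = O(d) and ∑_{m ≤ d} a_m / m ≤ ϑ log d + O(1). Both
follow from the logarithmic growth of G on the real axis and a_m ≥ 0; the second also gives λ_n → ∞.
-/

namespace WeightedPerm

/-! ### Cycle index sums over partitions. -/

/-- The centraliser order `z_λ = ∏ λ_i ∏ (multiplicities)!` of a multiset of cycle lengths. -/
def centOrder (s : Multiset ℕ) : ℕ :=
  s.prod * ∏ m ∈ s.toFinset, (s.count m).factorial

theorem centOrder_eq_prod_of_subset (s : Multiset ℕ) (t : Finset ℕ) (h : s.toFinset ⊆ t) :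
    centOrder s = s.prod * ∏ m ∈ t, (s.count m).factorial := by
  unfold centOrder
  congr 1
  refine Finset.prod_subset h fun m _ hm => ?_
  rw [Multiset.mem_toFinset, ← Multiset.count_eq_zero] at hm
  simp [hm]

theorem centOrder_cons (a : ℕ) (s : Multiset ℕ) :
    centOrder (a ::ₘ s) = a * (s.count a + 1) * centOrder s := by
  have h1 : s.toFinset ⊆ (a ::ₘ s).toFinset := by
    intro x; simp +contextual
  have ha : a ∈ (a ::ₘ s).toFinset := by simp
  rw [centOrder_eq_prod_of_subset s _ h1, centOrder, Multiset.prod_cons,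
    ← Finset.mul_prod_erase _ _ ha, ← Finset.mul_prod_erase _ (fun m => (s.count m).factorial) ha]
  have : ∏ x ∈ (a ::ₘ s).toFinset.erase a, ((a ::ₘ s).count x).factorial =
      ∏ x ∈ (a ::ₘ s).toFinset.erase a, (s.count x).factorial := by
    refine Finset.prod_congr rfl fun x hx => ?_
    rw [Multiset.count_cons_of_ne (Finset.ne_of_mem_erase hx)]
  rw [this, Multiset.count_cons_self, Nat.factorial_succ]
  ring

theorem centOrder_pos {n : ℕ} (p : n.Partition) : 0 < centOrder p.parts := by
  unfold centOrder
  have : 0 < p.parts.prod := Multiset.prod_pos fun _ h => p.parts_pos h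
  positivity

/-- The class size formula is known for `cycleType`, which omits fixed points. Splitting off the
parts equal to 1 identifies its factor (n - m.sum)! with the factorial of the multiplicity of 1. -/
theorem card_partition_eq_mul_centOrder {n : ℕ} (p : (Fintype.card (Fin n)).Partition) :
    (Finset.univ.filter fun σ : Equiv.Perm (Fin n) => σ.partition = p).card *
      centOrder p.parts = n.factorial := by
  set m := p.parts.filter (2 ≤ ·) with hm
  have hsplit : p.parts = m + Multiset.replicate (p.parts.count 1) 1 := by
    conv_lhs => rw [← Multiset.filter_add_not (2 ≤ ·) p.parts]
    congr 1
    rw [← Multiset.filter_eq']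
    refine Multiset.filter_congr fun x hx => ?_
    have := p.parts_pos hx
    omega
  have hsum : m.sum + p.parts.count 1 = n := by
    have := p.parts_sum
    rw [hsplit] at this
    simpa [hm] using this
  have hset : (Finset.univ.filter fun σ : Equiv.Perm (Fin n) => σ.partition = p) =
      Finset.univ.filter fun σ : Equiv.Perm (Fin n) => σ.cycleType = m := by
    ext σ
    simp only [Finset.mem_filter, Finset.mem_univ, true_and]
    constructor
    · rintro rfl
      rw [hm, Equiv.Perm.filter_parts_partition_eq_cycleType]
    · intro h
      rw [Nat.Partition.ext_iff, Equiv.Perm.parts_partition, h, ← Equiv.Perm.sum_cycleType, h]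
      conv_rhs => rw [hsplit]
      congr 2
      simp; omega
  have key := Equiv.Perm.card_of_cycleType_mul_eq (Fin n) m
  rw [if_pos ⟨by simp; omega, fun a ha => (Multiset.mem_filter.1 ha).2⟩, Fintype.card_fin] at key
  have hz : centOrder p.parts = (n - m.sum).factorial * m.prod *
      ∏ k ∈ m.toFinset, (m.count k).factorial := by
    have h1 : (1 : ℕ) ∉ m.toFinset := by simp [hm]
    have h2 : p.parts.toFinset ⊆ insert 1 m.toFinset := by
      intro x hx
      have hx' := Multiset.mem_toFinset.1 hx
      have := p.parts_pos hx'
      simp only [Finset.mem_insert, Multiset.mem_toFinset, hm, Multiset.mem_filter]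
      by_cases h : x = 1
      · exact Or.inl h
      · exact Or.inr ⟨hx', by omega⟩
    rw [centOrder_eq_prod_of_subset _ _ h2, Finset.prod_insert h1]
    have h3 : p.parts.prod = m.prod := by
      conv_lhs => rw [hsplit]
      simp
    have h4 : ∏ x ∈ m.toFinset, (p.parts.count x).factorial =
        ∏ x ∈ m.toFinset, (m.count x).factorial := by
      refine Finset.prod_congr rfl fun x hx => ?_
      have hx2 := (Multiset.mem_filter.1 (Multiset.mem_toFinset.1 hx)).2
      rw [hm, Multiset.count_filter_of_pos hx2]
    rw [h3, h4, show n - m.sum = p.parts.count 1 by omega]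
    ring
  rw [hset, hz]
  convert key using 3

/-- The weight of a multiset of cycle lengths in the cycle index. -/
noncomputable def partWeight (c : ℕ → ℂ) (s : Multiset ℕ) : ℂ :=
  (s.map c).prod / centOrder s

/-- The cycle index sum over the partitions of `n`. -/
noncomputable def cycleIndex (c : ℕ → ℂ) (n : ℕ) : ℂ :=
  ∑ p : n.Partition, partWeight c p.parts

theorem sum_perm_eq_cycleIndex (c : ℕ → ℂ) (n : ℕ) :
    (1 / (n.factorial : ℂ)) * ∑ σ : Equiv.Perm (Fin n), ((cycleLengths σ).map c).prod =
      cycleIndex c n := by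
  have h1 : ∑ σ : Equiv.Perm (Fin n), ((cycleLengths σ).map c).prod =
      ∑ p : (Fintype.card (Fin n)).Partition,
        ∑ σ : Equiv.Perm (Fin n) with σ.partition = p, ((cycleLengths σ).map c).prod := by
    rw [Finset.sum_fiberwise]
  have h2 : cycleIndex c n = cycleIndex c (Fintype.card (Fin n)) := by simp
  rw [h1, h2, cycleIndex, Finset.mul_sum]
  refine Finset.sum_congr rfl fun p _ => ?_
  have h3 : ∑ σ : Equiv.Perm (Fin n) with σ.partition = p, ((cycleLengths σ).map c).prod =
      ∑ σ : Equiv.Perm (Fin n) with σ.partition = p, (p.parts.map c).prod := by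
    refine Finset.sum_congr rfl fun σ hσ => ?_
    rw [cycleLengths, (Finset.mem_filter.1 hσ).2]
  rw [h3, Finset.sum_const, nsmul_eq_mul, partWeight]
  have h4 := card_partition_eq_mul_centOrder p
  have h5 : (centOrder p.parts : ℂ) ≠ 0 := by exact_mod_cast (centOrder_pos p).ne'
  have h6 : (n.factorial : ℂ) ≠ 0 := by exact_mod_cast n.factorial_ne_zero
  rw [← h4] at h6 ⊢
  push_cast at h6 ⊢
  have h7 := left_ne_zero_of_mul h6
  field_simp

theorem cycleIndex_zero (c : ℕ → ℂ) : cycleIndex c 0 = 1 := by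
  rw [cycleIndex, Fintype.sum_unique]
  simp [partWeight, centOrder]

/-- Write n as ∑ m · (multiplicity of m) in each partition and exchange sums; deleting one part m is
a bijection onto partitions of n - m, under which `centOrder` loses exactly the factor m ·
multiplicity. -/
theorem mul_cycleIndex (c : ℕ → ℂ) (n : ℕ) :
    (n : ℂ) * cycleIndex c n = ∑ m ∈ Finset.Icc 1 n, c m * cycleIndex c (n - m) := by
  have h1 : ∀ p : n.Partition, (n : ℂ) * partWeight c p.parts =
      ∑ m ∈ Finset.Icc 1 n, (m : ℂ) * (p.parts.count m : ℂ) * partWeight c p.parts := by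
    intro p
    rw [← Finset.sum_mul]
    congr 1
    have h := Finset.sum_multiset_count_of_subset p.parts (Finset.Icc 1 n) (by
      intro m hm
      have hm' := Multiset.mem_toFinset.1 hm
      exact Finset.mem_Icc.2 ⟨p.parts_pos hm', p.le_of_mem_parts hm'⟩)
    rw [p.parts_sum] at h
    conv_lhs => rw [h]
    push_cast
    refine Finset.sum_congr rfl fun m _ => ?_
    simp [mul_comm]
  rw [cycleIndex, Finset.mul_sum, Finset.sum_congr rfl fun p _ => h1 p, Finset.sum_comm]
  refine Finset.sum_congr rfl fun m hm => ?_
  obtain ⟨hm1, hmn⟩ := Finset.mem_Icc.1 hm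
  rw [cycleIndex, Finset.mul_sum]
  have h2 : ∑ p : n.Partition, (m : ℂ) * (p.parts.count m : ℂ) * partWeight c p.parts =
      ∑ p : {p : n.Partition // m ∈ p.parts},
        (m : ℂ) * (p.1.parts.count m : ℂ) * partWeight c p.1.parts := by
    rw [← Finset.sum_subtype (Finset.univ.filter fun p : n.Partition => m ∈ p.parts) (by simp)
      (fun p : n.Partition => (m : ℂ) * (p.parts.count m : ℂ) * partWeight c p.parts)]
    refine (Finset.sum_filter_of_ne fun p _ hp => ?_).symm
    contrapose! hp
    simp [Multiset.count_eq_zero_of_notMem hp]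
  rw [h2, ← (Nat.Partition.partitionWithPartEquiv hm1 hmn).symm.sum_comp]
  refine Finset.sum_congr rfl fun q _ => ?_
  rw [Nat.Partition.partitionWithPartEquiv_symm_apply_parts, Multiset.count_cons_self, partWeight,
    partWeight, centOrder_cons, Multiset.map_cons, Multiset.prod_cons]
  have h3 : (centOrder q.parts : ℂ) ≠ 0 := by exact_mod_cast (centOrder_pos q).ne'
  have h4 : (m : ℂ) ≠ 0 := by exact_mod_cast (by omega : m ≠ 0)
  have h5 : ((q.parts.count m + 1 : ℕ) : ℂ) ≠ 0 := Nat.cast_ne_zero.2 (Nat.succ_ne_zero _)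
  push_cast at h5 ⊢
  field_simp

/-- The `n`-th Taylor coefficient at the origin. -/
noncomputable def taylorCoeff (F : ℂ → ℂ) (n : ℕ) : ℂ :=
  iteratedDeriv n F 0 / n.factorial

/-- Leibniz's rule applied to (e^P)' = e^P P'. -/
theorem mul_taylorCoeff_exp {P : ℂ → ℂ} (hP : AnalyticAt ℂ P 0) (n : ℕ) :
    (n : ℂ) * taylorCoeff (fun z => Complex.exp (P z)) n =
      ∑ m ∈ Finset.Icc 1 n, (m * taylorCoeff P m) *
        taylorCoeff (fun z => Complex.exp (P z)) (n - m) := by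
  rcases n with _ | n
  · simp
  have hF : AnalyticAt ℂ (fun z => Complex.exp (P z)) 0 := hP.cexp
  have hd : deriv (fun z => Complex.exp (P z)) =ᶠ[𝓝 0]
      (fun z => Complex.exp (P z)) * deriv P := by
    filter_upwards [hP.eventually_analyticAt] with z hz
    simpa using hz.differentiableAt.hasDerivAt.cexp.deriv
  have h1 : iteratedDeriv (n + 1) (fun z => Complex.exp (P z)) 0 =
      ∑ i ∈ Finset.range (n + 1), n.choose i * iteratedDeriv i (fun z => Complex.exp (P z)) 0 *
        iteratedDeriv (n - i + 1) P 0 := by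
    rw [iteratedDeriv_succ', hd.iteratedDeriv_eq, iteratedDeriv_mul hF.contDiffAt
      hP.deriv.contDiffAt]
    simp only [← iteratedDeriv_succ']
  have h2 : ∑ m ∈ Finset.Icc 1 (n + 1), (m * taylorCoeff P m) *
        taylorCoeff (fun z => Complex.exp (P z)) (n + 1 - m) =
      ∑ i ∈ Finset.range (n + 1), (((n - i + 1 : ℕ) : ℂ) * taylorCoeff P (n - i + 1)) *
        taylorCoeff (fun z => Complex.exp (P z)) i := by
    refine Finset.sum_bij' (fun m _ => n + 1 - m) (fun i _ => n - i + 1) ?_ ?_ ?_ ?_ ?_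
    · intro m hm; simp at hm ⊢; omega
    · intro m hm; simp at hm ⊢
    · intro m hm; simp at hm ⊢; omega
    · intro m hm; simp at hm ⊢; omega
    · intro m hm
      simp at hm
      rw [show n - (n + 1 - m) + 1 = m by omega]
  rw [h2, taylorCoeff, h1, Finset.sum_div, Finset.mul_sum]
  refine Finset.sum_congr rfl fun i hi => ?_
  have hi' : i ≤ n := by simpa [Nat.lt_succ_iff] using hi
  have hc := Nat.choose_mul_factorial_mul_factorial hi'
  have hc' : ((n.choose i : ℕ) : ℂ) * i.factorial * (n - i).factorial = n.factorial := by
    exact_mod_cast hc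
  rw [taylorCoeff, taylorCoeff, Nat.factorial_succ, Nat.factorial_succ, Nat.cast_mul,
    Nat.cast_mul, ← hc']
  have e1 : ((n + 1 : ℕ) : ℂ) ≠ 0 := Nat.cast_ne_zero.2 (Nat.succ_ne_zero _)
  have e2 : ((n - i + 1 : ℕ) : ℂ) ≠ 0 := Nat.cast_ne_zero.2 (Nat.succ_ne_zero _)
  have e3 : (i.factorial : ℂ) ≠ 0 := by exact_mod_cast i.factorial_ne_zero
  have e4 : ((n - i).factorial : ℂ) ≠ 0 := by exact_mod_cast (n - i).factorial_ne_zero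
  have e5 : ((n.choose i : ℕ) : ℂ) ≠ 0 := by exact_mod_cast (Nat.choose_pos hi').ne'
  field_simp

/-- The exponential formula: both sides satisfy the same recurrence and equal 1 at n = 0. Only the
coefficients of P up to n matter, so lengths beyond n are harmless. -/
theorem taylorCoeff_exp_eq_cycleIndex {P : ℂ → ℂ} (hP : AnalyticAt ℂ P 0) (h0 : P 0 = 0)
    (c : ℕ → ℂ) (n : ℕ) (hc : ∀ m ∈ Finset.Icc 1 n, c m = m * taylorCoeff P m) :
    taylorCoeff (fun z => Complex.exp (P z)) n = cycleIndex c n := by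
  induction n using Nat.strong_induction_on with
  | _ n ih =>
    rcases n.eq_zero_or_pos with rfl | hn
    · simp [taylorCoeff, h0, cycleIndex_zero]
    · have hn' : (n : ℂ) ≠ 0 := by exact_mod_cast hn.ne'
      refine mul_left_cancel₀ hn' ?_
      rw [mul_taylorCoeff_exp hP, mul_cycleIndex]
      refine Finset.sum_congr rfl fun m hm => ?_
      have hm' := Finset.mem_Icc.1 hm
      rw [ih (n - m) (by omega), hc m hm]
      intro k hk
      refine hc k ?_
      simp at hk ⊢
      omega

theorem taylorCoeff_eq_of_hasSum {F : ℂ → ℂ} {a : ℕ → ℂ}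
    (h : ∀ᶠ z in 𝓝 (0 : ℂ), HasSum (fun n => a n * z ^ n) (F z)) (n : ℕ) :
    AnalyticAt ℂ F 0 ∧ taylorCoeff F n = a n := by
  have hp : HasFPowerSeriesAt F (FormalMultilinearSeries.ofScalars ℂ a) 0 := by
    rw [hasFPowerSeriesAt_iff]
    filter_upwards [h] with z hz
    simpa [FormalMultilinearSeries.coeff_ofScalars, mul_comm] using hz
  refine ⟨hp.analyticAt, ?_⟩
  have h1 := hp.eq_formalMultilinearSeries (hp.analyticAt.hasFPowerSeriesAt)
  have h2 := congrArg (fun p => FormalMultilinearSeries.coeff p n) h1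
  simp only [FormalMultilinearSeries.coeff_ofScalars] at h2
  rw [h2, taylorCoeff]

theorem hasSum_of_forall_eq {f g : ℕ → ℂ} {x : ℂ} (h : HasSum f x) (e : ∀ m, g m = f m) :
    HasSum g x :=
  (funext e : g = f) ▸ h

/-! ### Geometry of the slit disc in exponential coordinates. -/

open Complex in
theorem lt_abs_arg_of_re_mul_sin_lt {φ : ℝ} (h1 : φ < Real.pi / 2) {z : ℂ}
    (h : z.re * Real.sin φ < z.im * Real.cos φ) : φ < |z.arg| := by
  by_contra! hle
  have h2 := abs_le.1 hle
  have h3 : z.im * Real.cos φ - z.re * Real.sin φ = ‖z‖ * Real.sin (z.arg - φ) := by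
    rw [Real.sin_sub, ← norm_mul_cos_arg z, ← norm_mul_sin_arg z]
    simp only [Complex.norm_mul_cos_arg, Complex.norm_mul_sin_arg]
    have e1 := norm_mul_cos_arg z
    have e2 := norm_mul_sin_arg z
    linear_combination (-Real.cos φ) * e2 + Real.sin φ * e1
  have h4 : Real.sin (z.arg - φ) ≤ 0 :=
    Real.sin_nonpos_of_nonpos_of_neg_pi_le (by linarith) (by linarith)
  nlinarith [norm_nonneg z]

open Complex in
theorem re_mul_sin_lt_of_lt_abs_arg {φ : ℝ} (h0 : 0 < φ) {z : ℂ} (h : φ < |z.arg|) :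
    z.re * Real.sin φ < |z.im| * Real.cos φ := by
  have hz : 0 < ‖z‖ := by
    rw [norm_pos_iff]
    rintro rfl
    simp at h
    linarith
  have key : z.re * Real.sin φ = ‖z‖ * Real.cos |z.arg| * Real.sin φ := by
    rw [Real.cos_abs, norm_mul_cos_arg]
  have key2 : |z.im| = ‖z‖ * Real.sin |z.arg| := by
    rw [← norm_mul_sin_arg z, abs_mul, abs_norm, ← Real.abs_sin_eq_sin_abs_of_abs_le_pi
      (abs_arg_le_pi z)]
  rw [key, key2]
  have h3 : 0 < Real.sin (|z.arg| - φ) :=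
    Real.sin_pos_of_pos_of_lt_pi (by linarith) (by linarith [abs_arg_le_pi z])
  rw [Real.sin_sub] at h3
  nlinarith [mul_pos hz h3]

theorem isOpen_Delta {r R φ : ℝ} (h0 : 0 < φ) (h1 : φ < Real.pi / 2) : IsOpen (Delta r R φ) := by
  have : Delta r R φ =
      {z : ℂ | ‖z‖ < R} ∩ {z : ℂ | (z - r).re * Real.sin φ < |(z - r).im| * Real.cos φ} := by
    ext z
    constructor
    · rintro ⟨a, b, c⟩
      exact ⟨a, re_mul_sin_lt_of_lt_abs_arg h0 c⟩
    · rintro ⟨a, b⟩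
      have harg : φ < |(z - r).arg| := by
        rcases abs_choice (z - r).im with h | h
        · exact lt_abs_arg_of_re_mul_sin_lt h1 (by rw [← h]; exact b)
        · have := lt_abs_arg_of_re_mul_sin_lt (z := (starRingEnd ℂ) (z - r)) h1 (by
            rw [Complex.conj_im, ← h, Complex.conj_re]; exact b)
          rw [Complex.arg_conj] at this
          split_ifs at this with h'
          · rwa [h']
          · rwa [abs_neg] at this
      refine ⟨a, fun h => ?_, harg⟩
      simp [h] at harg
      linarith
  rw [this]
  exact (isOpen_lt (by fun_prop) (by fun_prop)).inter (isOpen_lt (by fun_prop) (by fun_prop))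

/-- The derivative in y is -(1 + c²) e^{cy} sin y ≤ 0. With c = cot φ this says that the exponential
of the ray of angle φ from 0 stays on or above the ray of angle φ from 1, as long as its height is
at most π. -/
theorem exp_mul_cos_sub_le_one (c : ℝ) {y : ℝ} (h0 : 0 ≤ y) (h1 : y ≤ Real.pi) :
    Real.exp (c * y) * (Real.cos y - c * Real.sin y) ≤ 1 := by
  have hd : ∀ x : ℝ, HasDerivAt (fun y => Real.exp (c * y) * (Real.cos y - c * Real.sin y))
      (-(Real.exp (c * x) * (1 + c ^ 2) * Real.sin x)) x := by
    intro x
    have e1 : HasDerivAt (fun y : ℝ => Real.exp (c * y)) (Real.exp (c * x) * (c * 1)) x :=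
      ((hasDerivAt_id x).const_mul c).exp
    have e2 : HasDerivAt (fun y : ℝ => Real.cos y - c * Real.sin y)
        (-Real.sin x - c * Real.cos x) x :=
      (Real.hasDerivAt_cos x).sub ((Real.hasDerivAt_sin x).const_mul c)
    refine (e1.mul e2).congr_deriv ?_
    ring
  have hanti : AntitoneOn (fun y => Real.exp (c * y) * (Real.cos y - c * Real.sin y))
      (Set.Icc 0 Real.pi) := by
    refine antitoneOn_of_deriv_nonpos (convex_Icc _ _)
      (fun x _ => (hd x).continuousAt.continuousWithinAt)
      (fun x _ => (hd x).differentiableAt.differentiableWithinAt) fun x hx => ?_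
    rw [interior_Icc] at hx
    rw [(hd x).deriv, neg_nonpos]
    have := Real.sin_pos_of_mem_Ioo hx
    positivity
  have := hanti (Set.left_mem_Icc.2 Real.pi_pos.le) ⟨h0, h1⟩ h0
  simpa using this

/-- A convex region which the exponential maps into the slit disc `Δ₀(1, R, φ)`. -/
def upperRegion (R φ : ℝ) : Set ℂ :=
  {v | v.re < Real.log R ∧ v.re * Real.sin φ < v.im * Real.cos φ ∧ v.im < Real.pi + φ}

theorem isOpen_upperRegion (R φ : ℝ) : IsOpen (upperRegion R φ) := by
  have e1 : IsOpen {v : ℂ | v.re < Real.log R} := isOpen_lt (by fun_prop) (by fun_prop)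
  have e2 : IsOpen {v : ℂ | v.re * Real.sin φ < v.im * Real.cos φ} :=
    isOpen_lt (by fun_prop) (by fun_prop)
  have e3 : IsOpen {v : ℂ | v.im < Real.pi + φ} := isOpen_lt (by fun_prop) (by fun_prop)
  exact e1.inter (e2.inter e3)

theorem convex_upperRegion (R φ : ℝ) : Convex ℝ (upperRegion R φ) := by
  intro v hv w hw a b ha hb hab
  obtain ⟨v1, v2, v3⟩ := hv
  obtain ⟨w1, w2, w3⟩ := hw
  have key : ∀ {x y c d : ℝ}, x < c → y < d → a * x + b * y < a * c + b * d := by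
    intro x y c d h1 h2
    rcases ha.eq_or_lt with rfl | ha
    · have : b = 1 := by linarith
      subst this; linarith
    · nlinarith
  have hb' : b = 1 - a := by linarith
  refine ⟨?_, ?_, ?_⟩
  · have := key v1 w1
    simp
    calc _ < _ := this
      _ = _ := by rw [hb']; ring
  · have := key v2 w2
    simp
    nlinarith
  · have := key v3 w3
    simp
    calc _ < _ := this
      _ = _ := by rw [hb']; ring

theorem exp_mem_Delta_of_mem_upperRegion {R φ : ℝ} (hR : 1 < R) (h0 : 0 < φ)
    (h1 : φ < Real.pi / 2) {v : ℂ} (hv : v ∈ upperRegion R φ) : Complex.exp v ∈ Delta 1 R φ := by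
  obtain ⟨v1, v2, v3⟩ := hv
  have hs : 0 < Real.sin φ := Real.sin_pos_of_pos_of_lt_pi h0 (by linarith [Real.pi_pos])
  have hc : 0 < Real.cos φ := Real.cos_pos_of_mem_Ioo ⟨by linarith, h1⟩
  have hnorm : ‖Complex.exp v‖ < R := by
    rw [Complex.norm_exp, ← Real.exp_log (by linarith : 0 < R)]
    exact Real.exp_lt_exp.2 v1
  have harg : φ < |Complex.arg (Complex.exp v - 1)| := by
    rcases lt_or_ge v.re 0 with hx | hx
    · have hre : (Complex.exp v - 1).re < 0 := by
        have h2 : (Complex.exp v).re ≤ ‖Complex.exp v‖ := Complex.re_le_norm _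
        rw [Complex.norm_exp] at h2
        have h3 : Real.exp v.re < 1 := by rw [← Real.exp_zero]; exact Real.exp_lt_exp.2 hx
        simp only [Complex.sub_re, Complex.one_re]
        linarith
      by_contra! hle
      have := (Complex.abs_arg_le_pi_div_two_iff).1 (hle.trans h1.le)
      linarith
    · refine lt_abs_arg_of_re_mul_sin_lt h1 ?_
      have hy : 0 < v.im := by
        have : 0 ≤ v.re * Real.sin φ := by positivity
        exact pos_of_mul_pos_left (this.trans_lt v2) hc.le
      simp only [Complex.sub_re, Complex.one_re, Complex.sub_im, Complex.one_im,
        Complex.exp_re, Complex.exp_im]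
      -- This is the imaginary part of (e^v - 1) e^{-iφ}.
      suffices h : 0 < Real.exp v.re * Real.sin (v.im - φ) + Real.sin φ by
        rw [Real.sin_sub] at h
        linarith
      rcases le_or_gt φ v.im with hy2 | hy2
      · have : 0 ≤ Real.sin (v.im - φ) :=
          Real.sin_nonneg_of_nonneg_of_le_pi (by linarith) (by linarith)
        positivity
      · have h4 := exp_mul_cos_sub_le_one (Real.cos φ / Real.sin φ) hy.le
          (by linarith [Real.pi_pos])
        have h5 : Real.cos v.im - Real.cos φ / Real.sin φ * Real.sin v.im =
            Real.sin (φ - v.im) / Real.sin φ := by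
          rw [Real.sin_sub]; field_simp
        have h6 : 0 < Real.sin (φ - v.im) :=
          Real.sin_pos_of_pos_of_lt_pi (by linarith) (by linarith [Real.pi_pos])
        rw [h5, mul_div_assoc', div_le_one hs] at h4
        have h7 : v.re < Real.cos φ / Real.sin φ * v.im := by
          rw [div_mul_eq_mul_div, lt_div_iff₀ hs]; linarith
        have h8 := mul_lt_mul_of_pos_right (Real.exp_lt_exp.2 h7) h6
        have h9 : Real.sin (v.im - φ) = -Real.sin (φ - v.im) := by
          rw [← Real.sin_neg]; ring_nf
        rw [h9]
        linarith
  refine ⟨hnorm, ?_, by simpa using harg⟩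
  intro h
  rw [h] at harg
  simp at harg
  linarith

theorem conj_mem_Delta {r R φ : ℝ} {z : ℂ} (hz : z ∈ Delta r R φ) :
    (starRingEnd ℂ) z ∈ Delta r R φ := by
  obtain ⟨h1, h2, h3⟩ := hz
  refine ⟨by simpa using h1, ?_, ?_⟩
  · intro h
    apply h2
    rw [← Complex.conj_conj z, h, Complex.conj_ofReal]
  · have : (starRingEnd ℂ) z - (r : ℂ) = (starRingEnd ℂ) (z - r) := by simp
    rw [this, Complex.arg_conj]
    split_ifs with h
    · rw [h] at h3; exact h3
    · rwa [abs_neg]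

/-! ### Contour deformation and a Cauchy estimate for coefficients. -/

theorem integral_segment_eq_sub {Φ H : ℂ → ℂ} {U : Set ℂ} (hΦ : ∀ v ∈ U, HasDerivAt Φ (H v) v)
    (hH : ContinuousOn H U) (p e : ℂ) {l : ℝ} (hl : 0 ≤ l)
    (hU : ∀ s ∈ Set.Icc 0 l, p + (s : ℂ) * e ∈ U) :
    ∫ s in (0 : ℝ)..l, H (p + s * e) * e = Φ (p + l * e) - Φ p := by
  have hline : ∀ s : ℝ, HasDerivAt (fun s : ℝ => p + (s : ℂ) * e) e s := by
    intro s
    simpa using ((Complex.ofRealCLM.hasDerivAt (x := s)).mul_const e).const_add p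
  rw [intervalIntegral.integral_eq_sub_of_hasDerivAt (f := fun s : ℝ => Φ (p + s * e))]
  · simp
  · intro s hs
    rw [Set.uIcc_of_le hl] at hs
    exact (hΦ _ (hU s hs)).comp s (hline s)
  · refine ContinuousOn.intervalIntegrable ?_
    rw [Set.uIcc_of_le hl]
    refine ContinuousOn.mul (hH.comp (by fun_prop) hU) continuousOn_const

theorem Convex.add_smul_mem_of_endpoints {U : Set ℂ} (hU : Convex ℝ U) {p e : ℂ} {l : ℝ}
    (hp : p ∈ U) (hq : p + l * e ∈ U) {s : ℝ} (hs : s ∈ Set.Icc 0 l) : p + (s : ℂ) * e ∈ U := by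
  rcases hs.1.eq_or_lt with h | h
  · simpa [← h] using hp
  · have hl : 0 < l := h.trans_le hs.2
    have := hU hp hq (a := 1 - s / l) (b := s / l) (by
      rw [sub_nonneg, div_le_one hl]; exact hs.2) (by positivity) (by ring)
    convert this using 1
    simp only [Complex.real_smul]
    push_cast
    have : (l : ℂ) ≠ 0 := by exact_mod_cast hl.ne'
    field_simp
    ring

-- On the convex region H has a primitive, so the path a → a + πi → δ + πi may be replaced by a → δ
-- + i y₀ → δ + πi, whose first leg is the ray of angle φ. The horizontal leg at height π is kept on
-- the left because it cancels later against its mirror image.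
open Complex in
theorem norm_vertical_integral_le {R φ : ℝ} (h0 : 0 < φ)
    (h1 : φ < Real.pi / 2) {H : ℂ → ℂ} (hH : DifferentiableOn ℂ H (upperRegion R φ))
    {a δ : ℝ} (ha : a < 0) (hδ : 0 < δ) (hδR : δ < Real.log R)
    (hδπ : (δ - a) * Real.tan φ < Real.pi) {b : ℝ → ℝ} {M : ℝ}
    (hb : ContinuousOn b (Set.Icc 0 ((δ - a) / Real.cos φ)))
    (hbH : ∀ s ∈ Set.Icc 0 ((δ - a) / Real.cos φ), ‖H (a + s * exp (φ * I))‖ ≤ b s)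
    (hM : ∀ y ∈ Set.Icc ((δ - a) * Real.tan φ) Real.pi, ‖H (δ + y * I)‖ ≤ M) :
    ‖(∫ y in (0 : ℝ)..Real.pi, H (a + y * I)) * I +
      ∫ x in (0 : ℝ)..(δ - a), H (a + Real.pi * I + x * 1)‖ ≤
      (∫ s in (0 : ℝ)..((δ - a) / Real.cos φ), b s) + M * Real.pi := by
  set U := upperRegion R φ
  have hUo : IsOpen U := isOpen_upperRegion R φ
  have hUc : Convex ℝ U := convex_upperRegion R φ
  have hs : 0 < Real.sin φ := Real.sin_pos_of_pos_of_lt_pi h0 (by linarith [Real.pi_pos])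
  have hc : 0 < Real.cos φ := Real.cos_pos_of_mem_Ioo ⟨by linarith, h1⟩
  have hπ := Real.pi_pos
  obtain ⟨Φ, hΦ'⟩ := hUc.exists_forall_hasDerivWithinAt hH
  have hΦ : ∀ v ∈ U, HasDerivAt Φ (H v) v := fun v hv =>
    (hΦ' v hv).hasDerivAt (hUo.mem_nhds hv)
  set y0 := (δ - a) * Real.tan φ with hy0
  set l := (δ - a) / Real.cos φ with hl
  have hlpos : 0 < l := by have : 0 < δ - a := by linarith
                           positivity
  have hy0pos : 0 < y0 := by
    have : 0 < Real.tan φ := Real.tan_pos_of_pos_of_lt_pi_div_two h0 h1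
    exact mul_pos (by linarith) this
  have htan : Real.tan φ * Real.cos φ = Real.sin φ := Real.tan_mul_cos hc.ne'
  have hy0c : y0 * Real.cos φ = (δ - a) * Real.sin φ := by rw [hy0, mul_assoc, htan]
  have hU1 : (a : ℂ) ∈ U := by
    refine ⟨?_, ?_, ?_⟩ <;> simp
    · linarith
    · nlinarith
    · linarith
  have hP : (a : ℂ) + l * exp (φ * I) = δ + y0 * I := by
    rw [exp_mul_I, ← ofReal_cos, ← ofReal_sin]
    have l1 : l * Real.cos φ = δ - a := by rw [hl]; field_simp
    have l2 : l * Real.sin φ = y0 := by rw [← htan, hy0, ← l1]; ring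
    have l1' : (l : ℂ) * (Real.cos φ : ℂ) = δ - a := by exact_mod_cast l1
    have l2' : (l : ℂ) * (Real.sin φ : ℂ) = y0 := by exact_mod_cast l2
    linear_combination l1' + I * l2'
  have hU2 : (δ : ℂ) + y0 * I ∈ U := by
    refine ⟨?_, ?_, ?_⟩ <;> simp
    · linarith
    · rw [hy0c]; nlinarith
    · linarith
  have hU3 : (δ : ℂ) + Real.pi * I ∈ U := by
    refine ⟨?_, ?_, ?_⟩ <;> simp
    · linarith
    · nlinarith
    · linarith
  have hU4 : (a : ℂ) + Real.pi * I ∈ U := by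
    refine ⟨?_, ?_, ?_⟩ <;> simp
    · linarith
    · nlinarith
    · linarith
  have hP2 : (δ : ℂ) + y0 * I + (Real.pi - y0 : ℝ) * I = δ + Real.pi * I := by push_cast; ring
  have hP3 : (a : ℂ) + Real.pi * I + (δ - a : ℝ) * 1 = δ + Real.pi * I := by push_cast; ring
  have I1 := integral_segment_eq_sub hΦ hH.continuousOn a (exp (φ * I)) hlpos.le
    (fun s hs => Convex.add_smul_mem_of_endpoints hUc hU1 (by rw [hP]; exact hU2) hs)
  have I2 := integral_segment_eq_sub hΦ hH.continuousOn (δ + y0 * I) I (l := Real.pi - y0)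
    (by linarith)
    (fun s hs => Convex.add_smul_mem_of_endpoints hUc hU2 (by rw [hP2]; exact hU3) hs)
  have I3 := integral_segment_eq_sub hΦ hH.continuousOn a I hπ.le
    (fun s hs => Convex.add_smul_mem_of_endpoints hUc hU1 hU4 hs)
  have I4 := integral_segment_eq_sub hΦ hH.continuousOn (a + Real.pi * I) 1 (l := δ - a)
    (by linarith)
    (fun s hs => Convex.add_smul_mem_of_endpoints hUc hU4 (by rw [hP3]; exact hU3) hs)
  rw [hP] at I1
  rw [hP2] at I2
  rw [hP3] at I4
  simp only [mul_one] at I4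
  rw [intervalIntegral.integral_mul_const] at I3
  simp only [mul_one]
  rw [I3, I4]
  have e : Φ (a + Real.pi * I) - Φ a + (Φ (δ + Real.pi * I) - Φ (a + Real.pi * I)) =
      (Φ (δ + y0 * I) - Φ a) + (Φ (δ + Real.pi * I) - Φ (δ + y0 * I)) := by ring
  rw [e, ← I1, ← I2]
  refine (norm_add_le _ _).trans (add_le_add ?_ ?_)
  · refine intervalIntegral.norm_integral_le_of_norm_le hlpos.le ?_ ?_
    · refine Eventually.of_forall fun s hs => ?_
      rw [norm_mul, norm_exp_ofReal_mul_I, mul_one]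
      exact hbH s ⟨hs.1.le, hs.2⟩
    · refine ContinuousOn.intervalIntegrable ?_
      rwa [Set.uIcc_of_le hlpos.le]
  · have hM' : ∀ y ∈ Set.uIoc (0 : ℝ) (Real.pi - y0), ‖H (δ + y0 * I + y * I) * I‖ ≤ M := by
      intro y hy
      rw [Set.uIoc_of_le (by linarith)] at hy
      rw [norm_mul, norm_I, mul_one]
      have := hM (y0 + y) ⟨by linarith [hy.1], by linarith [hy.2]⟩
      convert this using 3
      push_cast; ring
    have h2 := intervalIntegral.norm_integral_le_of_norm_le_const hM'
    have hM0 : 0 ≤ M := (norm_nonneg _).trans (hM Real.pi ⟨hδπ.le, le_rfl⟩)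
    rw [sub_zero, abs_of_nonneg (by linarith)] at h2
    nlinarith

open Complex in
theorem two_pi_mul_taylorCoeff {F : ℂ → ℂ} (hF : DifferentiableOn ℂ F (Metric.ball 0 1)) (n : ℕ)
    {a : ℝ} (ha : a < 0) :
    (2 * Real.pi : ℂ) * taylorCoeff F n =
      (∫ y in (0 : ℝ)..Real.pi, F (exp (a + y * I)) * exp (-n * (a + y * I))) +
      ∫ y in (0 : ℝ)..Real.pi, F (exp (a + -y * I)) * exp (-n * (a + -y * I)) := by
  have hρ : 0 < Real.exp a := Real.exp_pos a
  have hρ1 : Real.exp a < 1 := by rw [← Real.exp_zero]; exact Real.exp_lt_exp.2 ha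
  have h1 := Complex.circleIntegral_one_div_sub_center_pow_smul_of_differentiable_on_off_countable
    (f := F) (c := 0) (s := ∅) hρ n Set.countable_empty
    (hF.continuousOn.mono (Metric.closedBall_subset_ball hρ1))
    (fun z hz => (hF.differentiableAt (Metric.isOpen_ball.mem_nhds
      (Metric.ball_subset_ball hρ1.le hz.1))))
  set g : ℝ → ℂ := fun y => F (exp (a + y * I)) * exp (-n * (a + y * I)) with hg
  have hcm : ∀ θ : ℝ, circleMap 0 (Real.exp a) θ = exp (a + θ * I) := by
    intro θ
    rw [circleMap_zero, exp_add, ofReal_exp]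
  have h2 : ∮ z in C(0, Real.exp a), (1 / (z - 0) ^ (n + 1)) • F z =
      I * ∫ y in (0 : ℝ)..(2 * Real.pi), g y := by
    rw [circleIntegral, ← intervalIntegral.integral_const_mul]
    refine intervalIntegral.integral_congr fun θ _ => ?_
    have e : exp (-n * (a + θ * I)) = (exp (a + θ * I) ^ n)⁻¹ := by
      rw [← exp_nat_mul, ← exp_neg]; ring_nf
    simp only [deriv_circleMap, hcm, smul_eq_mul, sub_zero, hg, e]
    have := exp_ne_zero (a + θ * I)
    field_simp
    ring
  have hper : Function.Periodic g (2 * Real.pi) := by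
    intro y
    have e1 : (a : ℂ) + (y + 2 * Real.pi : ℝ) * I = (a + y * I) + 2 * Real.pi * I := by
      push_cast; ring
    have e2 : -(n : ℂ) * ((a + y * I) + 2 * Real.pi * I) =
        -n * (a + y * I) + (-n : ℤ) * (2 * Real.pi * I) := by push_cast; ring
    simp only [hg, e1, e2, exp_periodic (a + y * I)]
    rw [exp_add (-(n : ℂ) * _), exp_int_mul_two_pi_mul_I, mul_one]
  have hcont : Continuous g := by
    have : Continuous fun y : ℝ => F (exp (a + y * I)) := by
      refine hF.continuousOn.comp_continuous (by fun_prop) fun y => ?_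
      rw [mem_ball_zero_iff, norm_exp]
      simpa using hρ1
    exact this.mul (by fun_prop)
  have h3 : ∫ y in (0 : ℝ)..(2 * Real.pi), g y =
      (∫ y in (0 : ℝ)..Real.pi, g y) + ∫ y in (0 : ℝ)..Real.pi, g (-y) := by
    have e := hper.intervalIntegral_add_eq 0 (-Real.pi)
    rw [zero_add, show -Real.pi + 2 * Real.pi = Real.pi by ring] at e
    rw [e, intervalIntegral.integral_comp_neg, neg_zero, add_comm,
      intervalIntegral.integral_add_adjacent_intervals (hcont.intervalIntegrable _ _)
        (hcont.intervalIntegrable _ _)]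
  rw [h2, h3] at h1
  have h4 : (∫ y in (0 : ℝ)..Real.pi, g y) + ∫ y in (0 : ℝ)..Real.pi, g (-y) =
      2 * Real.pi * taylorCoeff F n := by
    refine mul_left_cancel₀ I_ne_zero ?_
    rw [h1, taylorCoeff, smul_eq_mul]
    ring
  rw [← h4]
  simp only [hg, ofReal_neg]

theorem ball_subset_Delta {R φ : ℝ} (hR : 1 < R) (h1 : φ < Real.pi / 2) :
    Metric.ball (0 : ℂ) 1 ⊆ Delta 1 R φ := by
  intro z hz
  rw [mem_ball_zero_iff] at hz
  have hre : (z - 1).re < 0 := by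
    have := Complex.re_le_norm z
    simp only [Complex.sub_re, Complex.one_re]
    linarith
  refine ⟨hz.trans hR, ?_, ?_⟩
  · rintro rfl
    simp at hre
  · by_contra! hle
    have := (Complex.abs_arg_le_pi_div_two_iff).1 (hle.trans h1.le)
    simp only [Complex.ofReal_one] at this
    linarith

-- The upper half of the circle is deformed directly, the lower half after reflection by complex
-- conjugation; the two horizontal legs at height ±π cancel by 2πi-periodicity.
open Complex ComplexConjugate in
theorem norm_taylorCoeff_le {R φ : ℝ} (hR : 1 < R) (h0 : 0 < φ)
    (h1 : φ < Real.pi / 2) {F : ℂ → ℂ} (hF : DifferentiableOn ℂ F (Delta 1 R φ)) (n : ℕ)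
    {a δ : ℝ} (ha : a < 0) (hδ : 0 < δ) (hδR : δ < Real.log R)
    (hδπ : (δ - a) * Real.tan φ < Real.pi) {b : ℝ → ℝ} {M : ℝ}
    (hb : ContinuousOn b (Set.Icc 0 ((δ - a) / Real.cos φ)))
    (hbF : ∀ s ∈ Set.Icc 0 ((δ - a) / Real.cos φ),
      ‖F (exp (a + s * exp (φ * I)))‖ ≤ b s ∧ ‖F (conj (exp (a + s * exp (φ * I))))‖ ≤ b s)
    (hM : ∀ y ∈ Set.Icc ((δ - a) * Real.tan φ) Real.pi,
      ‖F (exp (δ + y * I))‖ ≤ M ∧ ‖F (conj (exp (δ + y * I)))‖ ≤ M) :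
    ‖taylorCoeff F n‖ ≤
      (∫ s in (0 : ℝ)..((δ - a) / Real.cos φ), b s * Real.exp (-n * (a + s * Real.cos φ))) +
        M * Real.exp (-n * δ) * Real.pi := by
  set H1 : ℂ → ℂ := fun v => F (exp v) * exp (-n * v) with hH1
  set H2 : ℂ → ℂ := conj ∘ (fun v => F (exp v) * exp (-n * v)) ∘ conj with hH2
  have hmem : ∀ v ∈ upperRegion R φ, exp v ∈ Delta 1 R φ := fun v hv =>
    exp_mem_Delta_of_mem_upperRegion hR h0 h1 hv
  have hFat : ∀ v ∈ upperRegion R φ, DifferentiableAt ℂ F (exp v) ∧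
      DifferentiableAt ℂ F (exp (conj v)) := by
    intro v hv
    refine ⟨hF.differentiableAt ((isOpen_Delta h0 h1).mem_nhds (hmem v hv)),
      hF.differentiableAt ((isOpen_Delta h0 h1).mem_nhds ?_)⟩
    rw [exp_conj]
    exact conj_mem_Delta (hmem v hv)
  have hd1 : DifferentiableOn ℂ H1 (upperRegion R φ) := fun v hv =>
    (((hFat v hv).1.comp v (differentiableAt_exp)).mul (by fun_prop)).differentiableWithinAt
  have hd2 : DifferentiableOn ℂ H2 (upperRegion R φ) := by
    intro v hv
    refine DifferentiableAt.differentiableWithinAt ?_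
    rw [hH2, differentiableAt_conj_conj_iff]
    exact ((hFat v hv).2.comp (conj v) (differentiableAt_exp)).mul (by fun_prop)
  have hH2' : ∀ v, H2 v = conj (F (conj (exp v)) * conj (exp (-n * v))) := by
    intro v
    simp only [hH2, Function.comp_apply, ← exp_conj, map_mul, map_neg, conj_conj]
    simp
  have hre1 : ∀ s : ℝ, ‖exp (-n * (a + s * exp (φ * I)))‖ = Real.exp (-n * (a + s * Real.cos φ)) := by
    intro s
    rw [norm_exp, exp_mul_I, ← ofReal_cos, ← ofReal_sin]
    simp [-ofReal_cos, -ofReal_sin]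
  have hre2 : ∀ s : ℝ, ‖exp (-n * (δ + s * I))‖ = Real.exp (-n * δ) := by
    intro s
    rw [norm_exp]
    simp
  have hbc : ContinuousOn (fun s => b s * Real.exp (-n * (a + s * Real.cos φ)))
      (Set.Icc 0 ((δ - a) / Real.cos φ)) := hb.mul (by fun_prop)
  have A1 := norm_vertical_integral_le h0 h1 hd1 ha hδ hδR hδπ hbc
    (M := M * Real.exp (-n * δ)) (fun s hs => by
      rw [hH1, norm_mul, hre1]
      exact mul_le_mul_of_nonneg_right (hbF s hs).1 (Real.exp_pos _).le)
    (fun y hy => by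
      rw [hH1, norm_mul, hre2]
      exact mul_le_mul_of_nonneg_right (hM y hy).1 (Real.exp_pos _).le)
  have A2 := norm_vertical_integral_le h0 h1 hd2 ha hδ hδR hδπ hbc
    (M := M * Real.exp (-n * δ)) (fun s hs => by
      rw [hH2', norm_conj, norm_mul, norm_conj, hre1]
      exact mul_le_mul_of_nonneg_right (hbF s hs).2 (Real.exp_pos _).le)
    (fun y hy => by
      rw [hH2', norm_conj, norm_mul, norm_conj, hre2]
      exact mul_le_mul_of_nonneg_right (hM y hy).2 (Real.exp_pos _).le)
  -- Conjugation sends height π to height -π, which differs by 2πi; the factor e^{-nv} has the same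
  -- period because n is an integer.
  have hT : ∀ x : ℝ, H2 (a + Real.pi * I + x * 1) = conj (H1 (a + Real.pi * I + x * 1)) := by
    intro x
    have e1 : conj ((a : ℂ) + Real.pi * I + x * 1) =
        (a + Real.pi * I + x * 1) - 2 * Real.pi * I := by
      simp; ring
    have e2 : -(n : ℂ) * ((a + Real.pi * I + x * 1) - 2 * Real.pi * I) =
        -n * (a + Real.pi * I + x * 1) + n * (2 * Real.pi * I) := by ring
    simp only [hH2, hH1, Function.comp_apply, e1, exp_periodic.sub_eq, e2]
    rw [exp_add (-(n : ℂ) * _), exp_nat_mul_two_pi_mul_I]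
    simp only [mul_one]
  have hJ : ∀ y : ℝ, H2 (a + y * I) = conj (H1 (a + -y * I)) := by
    intro y
    simp [hH2, hH1]
  simp only [hT, hJ] at A2
  have hconj : ∀ (f : ℝ → ℂ) (l : ℝ), ∫ y in (0 : ℝ)..l, conj (f y) =
      conj (∫ y in (0 : ℝ)..l, f y) := by
    intro f l
    simp only [intervalIntegral, integral_conj, map_sub]
  rw [hconj, hconj] at A2
  have h2 := two_pi_mul_taylorCoeff (hF.mono (ball_subset_Delta hR h1)) n ha
  set J1 := ∫ y in (0 : ℝ)..Real.pi, H1 (a + y * I)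
  set J2 := ∫ y in (0 : ℝ)..Real.pi, H1 (a + -y * I)
  set T := ∫ x in (0 : ℝ)..(δ - a), H1 (a + Real.pi * I + x * 1)
  have A3 : ‖-(J2 * I) + T‖ ≤ (∫ s in (0 : ℝ)..((δ - a) / Real.cos φ),
      b s * Real.exp (-n * (a + s * Real.cos φ))) + M * Real.exp (-n * δ) * Real.pi := by
    rw [← norm_conj]
    simpa using A2
  have h3 : 2 * Real.pi * taylorCoeff F n * I = (J1 * I + T) - (-(J2 * I) + T) := by
    rw [h2]; ring
  have h4 := congrArg norm h3
  rw [norm_mul, norm_mul, norm_I, mul_one] at h4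
  have h5 : ‖(2 * Real.pi : ℂ)‖ = 2 * Real.pi := by
    rw [show (2 * Real.pi : ℂ) = ((2 * Real.pi : ℝ) : ℂ) by push_cast; rfl, norm_real,
      Real.norm_of_nonneg (by positivity)]
  rw [h5] at h4
  have h6 := norm_sub_le (J1 * I + T) (-(J2 * I) + T)
  -- The two halves add up to twice the bound; the spare factor 1/π is discarded.
  have h7 : 2 * ‖taylorCoeff F n‖ ≤ 2 * Real.pi * ‖taylorCoeff F n‖ := by
    nlinarith [norm_nonneg (taylorCoeff F n), Real.pi_gt_three]
  linarith

/-! ### Partial sums of the weights. -/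

theorem pow_add_mul_le_add_pow {x y : ℝ} (hx : 0 ≤ x) (hy : 0 ≤ y) (m : ℕ) :
    x ^ (m + 1) + (m + 1) * x ^ m * y ≤ (x + y) ^ (m + 1) := by
  induction m with
  | zero => simp
  | succ m ih =>
    calc x ^ (m + 1 + 1) + ((m + 1 : ℕ) + 1) * x ^ (m + 1) * y
        ≤ (x ^ (m + 1) + (m + 1) * x ^ m * y) * (x + y) := by
          have : 0 ≤ (m + 1) * x ^ m * y * y := by positivity
          push_cast
          calc _ = x ^ (m + 1) * x + x ^ (m + 1) * y + (m + 1) * (x ^ m * x) * y := by ring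
            _ ≤ _ := by nlinarith
      _ ≤ (x + y) ^ (m + 1) * (x + y) := mul_le_mul_of_nonneg_right ih (by positivity)
      _ = _ := by ring

/-- An elementary Tauberian argument: compare g at x = 1 - 1/(2d) and x' = 1 - 1/(4d). Since -ϑ
log(1 - x) changes only by ϑ log 2, g(x') - g(x) is bounded, while non-negativity lets the terms m ≤
d be isolated. -/
theorem exists_partial_sum_le {a : ℕ → ℝ} (ha : ∀ m, 1 ≤ m → 0 ≤ a m) {ϑ : ℝ} (hϑ : 0 < ϑ)
    {g : ℝ → ℝ}
    (hg : ∀ x : ℝ, 0 ≤ x → x < 1 → HasSum (fun m : ℕ => a m / m * x ^ m) (g x))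
    {ε C : ℝ} (hε : 0 < ε)
    (hC : ∀ x : ℝ, 1 - ε < x → x < 1 → |g x + ϑ * Real.log (1 - x)| ≤ C) :
    ∃ B : ℝ, 0 < B ∧ ∀ d : ℕ, 1 ≤ d → ∑ m ∈ Finset.Icc 1 d, a m ≤ B * d ∧
      ∑ m ∈ Finset.Icc 1 d, a m / m ≤ ϑ * Real.log d + B := by
  have large : ∀ d : ℕ, 1 ≤ d → 1 / (2 * d : ℝ) < ε →
      ∑ m ∈ Finset.Icc 1 d, a m ≤ (8 * (ϑ * Real.log 2 + 2 * C)) * d ∧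
      ∑ m ∈ Finset.Icc 1 d, a m / m ≤
        ϑ * Real.log d + (ϑ * Real.log 2 + C + 4 * (ϑ * Real.log 2 + 2 * C)) := by
    intro d hd hdε
    have hd0 : (1 : ℝ) ≤ d := by exact_mod_cast hd
    set x : ℝ := 1 - 1 / (2 * d) with hx
    set x' : ℝ := 1 - 1 / (4 * d) with hx'
    have e1 : 0 < 1 / (2 * d : ℝ) := by positivity
    have e2 : 1 / (2 * d : ℝ) ≤ 1 / 2 := by
      rw [div_le_div_iff₀ (by positivity) (by positivity)]; linarith
    have e3 : 1 / (4 * d : ℝ) = 1 / (2 * d) / 2 := by field_simp; norm_num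
    have hx0 : 0 ≤ x := by linarith
    have hx1 : x < 1 := by linarith
    have hx'0 : 0 ≤ x' := by linarith
    have hx'1 : x' < 1 := by linarith
    have hxx' : x' = x + 1 / (4 * d) := by linarith
    have g1 := hC x (by linarith) hx1
    have g2 := hC x' (by linarith) hx'1
    have l1 : Real.log (1 - x) = -(Real.log 2 + Real.log d) := by
      rw [hx, sub_sub_cancel, one_div, Real.log_inv, Real.log_mul (by norm_num) (by positivity)]
    have l2 : Real.log (1 - x') = -(2 * Real.log 2 + Real.log d) := by
      rw [hx', sub_sub_cancel, one_div, Real.log_inv, Real.log_mul (by norm_num) (by positivity),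
        show (4 : ℝ) = 2 ^ 2 by norm_num, Real.log_pow]
      norm_num
    rw [l1, abs_le] at g1
    rw [l2, abs_le] at g2
    have hpow : ∀ m ∈ Finset.Icc 1 d, 1 / 2 ≤ x ^ (m - 1) := by
      intro m hm
      rw [Finset.mem_Icc] at hm
      have h1 := one_add_mul_le_pow (a := -(1 / (2 * d : ℝ))) (by linarith) d
      have h2 : x ^ d ≤ x ^ (m - 1) := pow_le_pow_of_le_one hx0 hx1.le (by omega)
      have h3 : 1 + (d : ℝ) * -(1 / (2 * d)) = 1 / 2 := by field_simp; norm_num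
      rw [h3, show 1 + -(1 / (2 * d : ℝ)) = x by rw [hx]; ring] at h1
      linarith
    -- The tangent bound gives x'^m - x^m ≥ m x^{m-1}/(4d) ≥ m/(8d) for 1 ≤ m ≤ d.
    have s1 : ∑ m ∈ Finset.Icc 1 d, a m * (1 / (8 * d)) ≤ g x' - g x := by
      refine le_trans (Finset.sum_le_sum fun m hm => ?_)
        (sum_le_hasSum (Finset.Icc 1 d) (fun m _ => ?_) ((hg x' hx'0 hx'1).sub (hg x hx0 hx1)))
      · have hp := hpow m hm
        rw [Finset.mem_Icc] at hm
        have ham := ha m hm.1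
        obtain ⟨k, rfl⟩ : ∃ k, m = k + 1 := ⟨m - 1, by omega⟩
        have hb := pow_add_mul_le_add_pow hx0 (y := 1 / (4 * d)) (by positivity) k
        rw [← hxx'] at hb
        simp only [Nat.add_sub_cancel] at hp
        have hk : (0 : ℝ) < ((k + 1 : ℕ) : ℝ) := by positivity
        rw [← mul_sub, div_mul_eq_mul_div, le_div_iff₀ hk, mul_assoc]
        refine mul_le_mul_of_nonneg_left ?_ ham
        have : (k + 1 : ℝ) * (1 / 2) * (1 / (4 * d)) ≤ (k + 1) * x ^ k * (1 / (4 * d)) := by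
          gcongr
        have e : (1 / (8 * d) : ℝ) * ((k + 1 : ℕ) : ℝ) = (k + 1 : ℝ) * (1 / 2) * (1 / (4 * d)) := by
          push_cast; field_simp; norm_num
        rw [e]
        linarith
      · rcases m.eq_zero_or_pos with rfl | hm
        · simp
        · rw [← mul_sub]
          refine mul_nonneg (div_nonneg (ha m hm) (by positivity)) (sub_nonneg.2 ?_)
          exact pow_le_pow_left₀ hx0 (by linarith) m
    rw [← Finset.sum_mul, mul_one_div, div_le_iff₀ (by positivity)] at s1
    have s2 : ∑ m ∈ Finset.Icc 1 d, a m ≤ (8 * (ϑ * Real.log 2 + 2 * C)) * d := by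
      refine s1.trans ?_
      have : g x' - g x ≤ ϑ * Real.log 2 + 2 * C := by nlinarith
      nlinarith
    refine ⟨s2, ?_⟩
    -- Bernoulli's inequality: x^m ≥ 1 - m/(2d).
    have s3 : ∑ m ∈ Finset.Icc 1 d, (a m / m - a m * (1 / (2 * d))) ≤ g x := by
      refine le_trans (Finset.sum_le_sum fun m hm => ?_)
        (sum_le_hasSum (Finset.Icc 1 d) (fun m _ => ?_) (hg x hx0 hx1))
      · rw [Finset.mem_Icc] at hm
        have ham := ha m hm.1
        have hm0 : (0 : ℝ) < m := by exact_mod_cast hm.1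
        have h1 := one_add_mul_le_pow (a := -(1 / (2 * d : ℝ))) (by linarith) m
        rw [show 1 + -(1 / (2 * d : ℝ)) = x by rw [hx]; ring] at h1
        have e : a m / m - a m * (1 / (2 * d)) = a m / m * (1 + m * -(1 / (2 * d))) := by
          field_simp; ring
        rw [e]
        exact mul_le_mul_of_nonneg_left h1 (by positivity)
      · rcases m.eq_zero_or_pos with rfl | hm
        · simp
        · exact mul_nonneg (div_nonneg (ha m hm) (by positivity)) (by positivity)
    rw [Finset.sum_sub_distrib, ← Finset.sum_mul] at s3
    have s4 : (∑ m ∈ Finset.Icc 1 d, a m) * (1 / (2 * d)) ≤ 4 * (ϑ * Real.log 2 + 2 * C) := by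
      rw [mul_one_div, div_le_iff₀ (by positivity)]
      linarith
    nlinarith
  -- For d below the threshold N', the sums are dominated by those at N', which only enlarges the
  -- constant.
  obtain ⟨N, hN⟩ := exists_nat_gt (1 / ε)
  set N' := max N 1
  set B1 := 8 * (ϑ * Real.log 2 + 2 * C)
  set B2 := ϑ * Real.log 2 + C + 4 * (ϑ * Real.log 2 + 2 * C)
  have hsmall : ∀ d : ℕ, N' ≤ d → 1 / (2 * d : ℝ) < ε := by
    intro d hd
    have h1 : (N : ℝ) ≤ d := by exact_mod_cast (le_max_left N 1).trans hd
    have h2 : 0 < (d : ℝ) := lt_of_lt_of_le (lt_trans (by positivity) hN) h1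
    rw [div_lt_iff₀ hε] at hN
    rw [div_lt_iff₀ (by positivity)]
    nlinarith
  refine ⟨max 1 (max (max B1 (B1 * N')) (max B2 (ϑ * Real.log N' + B2))), by positivity,
    fun d hd => ?_⟩
  have hd0 : (1 : ℝ) ≤ d := by exact_mod_cast hd
  have hlog : 0 ≤ Real.log d := Real.log_nonneg hd0
  set B := max 1 (max (max B1 (B1 * N')) (max B2 (ϑ * Real.log N' + B2)))
  have b1 : B1 ≤ B := by simp [B]
  have b2 : B1 * N' ≤ B := by simp [B]
  have b3 : B2 ≤ B := by simp [B]
  have b4 : ϑ * Real.log N' + B2 ≤ B := by simp [B]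
  rcases le_total N' d with h | h
  · obtain ⟨p1, p2⟩ := large d hd (hsmall d h)
    exact ⟨p1.trans (by gcongr), p2.trans (by gcongr)⟩
  · obtain ⟨p1, p2⟩ := large N' (le_max_right _ _) (hsmall N' le_rfl)
    have hsub : Finset.Icc 1 d ⊆ Finset.Icc 1 N' := Finset.Icc_subset_Icc le_rfl h
    constructor
    · calc _ ≤ ∑ m ∈ Finset.Icc 1 N', a m := Finset.sum_le_sum_of_subset_of_nonneg hsub
            fun m hm _ => ha m (Finset.mem_Icc.1 hm).1
        _ ≤ B * 1 := by rw [mul_one]; exact p1.trans b2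
        _ ≤ B * d := by gcongr
    · calc _ ≤ ∑ m ∈ Finset.Icc 1 N', a m / m := Finset.sum_le_sum_of_subset_of_nonneg hsub
            fun m hm _ => div_nonneg (ha m (Finset.mem_Icc.1 hm).1) (by positivity)
        _ ≤ B := p2.trans b4
        _ ≤ _ := by nlinarith

/-! ### Rescaling the singularity to 1. -/

theorem one_sub_mem_slitPlane {R φ : ℝ} (h0 : 0 < φ) {t : ℂ} (ht : t ∈ Delta 1 R φ) :
    1 - t ∈ Complex.slitPlane := by
  obtain ⟨-, h1, h2⟩ := ht
  rw [Complex.mem_slitPlane_iff]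
  by_contra! h
  obtain ⟨h3, h4⟩ := h
  have : (t - (1 : ℝ)).arg = 0 := by
    rw [Complex.arg_eq_zero_iff]
    simp at h3 h4 ⊢
    exact ⟨h3, h4⟩
  rw [this, abs_zero] at h2
  linarith

/-- The members of `𝓕(1, ϑ, K)` given by a power series, in a usable form. -/
structure LogSingular (a : ℕ → ℝ) (ϑ K R φ : ℝ) (G : ℂ → ℂ) (ε C : ℝ) : Prop where
  one_lt : 1 < R
  pos : 0 < φ
  lt_half_pi : φ < Real.pi / 2
  differentiableOn : DifferentiableOn ℂ G (Delta 1 R φ)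
  ε_pos : 0 < ε
  C_pos : 0 < C
  near : ∀ t ∈ Delta 1 R φ, ‖t - 1‖ < ε →
    ‖G t - (-(ϑ : ℂ) * Complex.log (1 - t) + K)‖ ≤ C * ‖t - 1‖
  hasSum : ∀ t : ℂ, ‖t‖ < 1 → HasSum (fun m : ℕ => ((a m / m : ℝ) : ℂ) * t ^ m) (G t)

/-- Take G(t) = g(rt). Its power series, known only near 0, converges to it on the whole unit disc
because G is holomorphic there. -/
theorem GenFunInClassF.exists_logSingular {θ : ℕ → ℝ} {r ϑ K : ℝ} (hr : 0 < r)
    (hg : GenFunInClassF θ r ϑ K) :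
    ∃ R φ G ε C, LogSingular (fun m => θ m * r ^ m) ϑ K R φ G ε C := by
  obtain ⟨g, ⟨R, φ, hR, h0, h1, hd, hO⟩, hs⟩ := hg
  have hrc : (r : ℂ) ≠ 0 := by exact_mod_cast hr.ne'
  have hmap : ∀ t ∈ Delta 1 (R / r) φ, (r : ℂ) * t ∈ Delta r R φ := by
    rintro t ⟨t1, t2, t3⟩
    refine ⟨?_, ?_, ?_⟩
    · rw [norm_mul, Complex.norm_real, Real.norm_of_nonneg hr.le]
      rw [lt_div_iff₀ hr] at t1
      linarith
    · intro h
      apply t2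
      have := mul_left_cancel₀ hrc (h.trans (mul_one (r : ℂ)).symm)
      simpa using this
    · rw [show (r : ℂ) * t - r = (r : ℂ) * (t - (1 : ℝ)) by push_cast; ring,
        Complex.arg_real_mul _ hr]
      exact t3
  rw [isBigO_iff'] at hO
  obtain ⟨c, hc, hO⟩ := hO
  rw [eventually_nhdsWithin_iff, Metric.eventually_nhds_iff] at hO
  obtain ⟨ε, hε, hO⟩ := hO
  have hd' : DifferentiableOn ℂ (fun t => g (r * t)) (Delta 1 (R / r) φ) :=
    hd.comp (by fun_prop) hmap
  refine ⟨R / r, φ, fun t => g (r * t), ε / r, c * r, ?_⟩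
  have hR' : 1 < R / r := by rwa [lt_div_iff₀ hr, one_mul]
  refine ⟨hR', h0, h1, hd', by positivity, by positivity, ?_, ?_⟩
  · intro t ht htε
    have h2 := hO (y := r * t) (by
      rw [dist_eq_norm, show (r : ℂ) * t - r = r * (t - 1) by ring, norm_mul, Complex.norm_real,
        Real.norm_of_nonneg hr.le]
      rw [lt_div_iff₀ hr] at htε
      linarith) (hmap t ht)
    have hlog : Complex.log (1 / (1 - r * t / r)) = -Complex.log (1 - t) := by
      rw [mul_div_cancel_left₀ _ hrc, one_div, Complex.log_inv]
      exact Complex.slitPlane_arg_ne_pi (one_sub_mem_slitPlane h0 ht)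
    rw [hlog, show (r : ℂ) * t - r = r * (t - 1) by ring, norm_mul, Complex.norm_real,
      Real.norm_of_nonneg hr.le, ← mul_assoc] at h2
    simpa using h2
  · have hs' : ∀ᶠ t : ℂ in 𝓝 0,
        HasSum (fun m : ℕ => ((θ m * r ^ m / m : ℝ) : ℂ) * t ^ m) (g (r * t)) := by
      have htend : Tendsto (fun t : ℂ => (r : ℂ) * t) (𝓝 0) (𝓝 0) := by
        have : Continuous fun t : ℂ => (r : ℂ) * t := by fun_prop
        simpa using this.tendsto 0
      filter_upwards [htend.eventually hs] with t ht
      rw [← hasSum_nat_add_iff' 1]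
      simp only [Finset.range_one, Finset.sum_singleton, Nat.cast_zero, div_zero,
        Complex.ofReal_zero, zero_mul, sub_zero]
      refine hasSum_of_forall_eq ht fun m => ?_
      push_cast
      ring
    intro t ht
    have hball : DifferentiableOn ℂ (fun t => g (r * t)) (Metric.ball 0 1) :=
      hd'.mono (ball_subset_Delta hR' h1)
    have h3 := Complex.hasSum_taylorSeries_on_ball hball (z := t) (by simpa using ht)
    refine hasSum_of_forall_eq h3 fun m => ?_
    rw [← (taylorCoeff_eq_of_hasSum hs' m).2, taylorCoeff, smul_eq_mul, sub_zero, smul_eq_mul]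
    ring

/-! ### Coefficients of (1 - t)^{-α} and the reciprocal Gamma function. -/

/-- The Taylor coefficients of `(1 - t) ^ (-α)`. -/
noncomputable def negBinom (α : ℂ) (n : ℕ) : ℂ := ∏ j ∈ Finset.range n, (α + j) / (j + 1)

theorem eventually_hasSum_neg_mul_log (α : ℂ) : ∀ᶠ z in 𝓝 (0 : ℂ),
    HasSum (fun m : ℕ => α / m * z ^ m) (-α * Complex.log (1 - z)) := by
  filter_upwards [Metric.ball_mem_nhds (0 : ℂ) one_pos] with z hz
  have := (Complex.hasSum_taylorSeries_neg_log (z := z) (by simpa using hz)).mul_left α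
  rw [mul_neg, ← neg_mul] at this
  exact hasSum_of_forall_eq this fun m => by ring

theorem cycleIndex_const (α : ℂ) (n : ℕ) : cycleIndex (fun _ => α) n = negBinom α n := by
  induction n with
  | zero => simp [cycleIndex_zero, negBinom]
  | succ n ih =>
    have h1 : ∀ n : ℕ, (n : ℂ) * cycleIndex (fun _ => α) n =
        α * ∑ k ∈ Finset.range n, cycleIndex (fun _ => α) k := by
      intro n
      rw [mul_cycleIndex, ← Finset.mul_sum, ← Finset.sum_range_reflect]
      congr 1
      refine Finset.sum_bij' (fun m _ => m - 1) (fun k _ => k + 1) ?_ ?_ ?_ ?_ ?_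
      · intro m hm; simp at hm ⊢; omega
      · intro m hm; simp at hm ⊢; omega
      · intro m hm; simp at hm ⊢; omega
      · intro m hm; simp at hm ⊢
      · intro m hm
        simp at hm
        congr 1; omega
    have h2 := h1 (n + 1)
    rw [Finset.sum_range_succ, mul_add, ← h1 n, ih, ← add_mul] at h2
    rw [negBinom, Finset.prod_range_succ, ← negBinom]
    have : (n + 1 : ℂ) ≠ 0 := by exact_mod_cast n.succ_ne_zero
    push_cast at h2
    field_simp
    linear_combination h2

theorem taylorCoeff_exp_neg_mul_log (α : ℂ) (n : ℕ) :
    taylorCoeff (fun z => Complex.exp (-α * Complex.log (1 - z))) n = negBinom α n := by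
  have h := taylorCoeff_eq_of_hasSum (eventually_hasSum_neg_mul_log α)
  rw [taylorCoeff_exp_eq_cycleIndex (h 0).1 (by simp) (fun _ => α), cycleIndex_const]
  intro m hm
  rw [(h m).2]
  have : (m : ℂ) ≠ 0 := by
    have := (Finset.mem_Icc.1 hm).1
    exact_mod_cast (by omega : m ≠ 0)
  field_simp

/-- The normalised coefficients, converging to `1 / Γ(α)`. -/
noncomputable def normNegBinom (α : ℂ) (n : ℕ) : ℂ :=
  n * Complex.exp (-α * Real.log n) * negBinom α n

/-- Up to the factor n/(α + n), the sequence is the inverse of the Gauss product `GammaSeq` for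
Γ(α). -/
theorem tendsto_normNegBinom (α : ℂ) :
    Tendsto (normNegBinom α) atTop (𝓝 (1 / Complex.Gamma α)) := by
  have hprod : ∀ n : ℕ, ∏ j ∈ Finset.range n, (α + j) = negBinom α n * n.factorial := by
    intro n
    rw [negBinom, Finset.prod_div_distrib, ← Finset.prod_range_add_one_eq_factorial]
    push_cast
    rw [div_mul_cancel₀]
    exact Finset.prod_ne_zero_iff.2 fun j _ => by exact_mod_cast j.succ_ne_zero
  have hkey : ∀ᶠ n : ℕ in atTop, normNegBinom α n = (Complex.GammaSeq α n)⁻¹ * (n / (α + n)) := by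
    filter_upwards [eventually_gt_atTop 0, eventually_gt_atTop ⌈‖α‖⌉₊] with n hn hnα
    have hn0 : (n : ℂ) ≠ 0 := by exact_mod_cast hn.ne'
    have hαn : α + n ≠ 0 := by
      intro h
      have h1 : α = -n := eq_neg_of_add_eq_zero_left h
      rw [h1, norm_neg, Complex.norm_natCast, Nat.ceil_natCast] at hnα
      omega
    rw [Complex.GammaSeq, Finset.prod_range_succ, hprod, normNegBinom, inv_div,
      Complex.cpow_def_of_ne_zero hn0, ← Complex.ofReal_natCast, ← Complex.ofReal_log (by positivity)]
    have hf : (n.factorial : ℂ) ≠ 0 := by exact_mod_cast n.factorial_ne_zero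
    rw [neg_mul, Complex.exp_neg, mul_comm α]
    have := Complex.exp_ne_zero (Real.log n * α)
    simp only [Complex.ofReal_natCast]
    field_simp
  have h1 : Tendsto (fun n : ℕ => (n : ℂ) / (α + n)) atTop (𝓝 1) := by
    have := tendsto_natCast_div_add_atTop (𝕜 := ℂ) α
    simpa [add_comm] using this
  -- `Complex.Gamma` takes the value 0 at its poles -m, and there 1/0 = 0 is the true value of 1/Γ:
  -- the coefficients vanish once n > m.
  rcases eq_or_ne (Complex.Gamma α) 0 with h0 | h0
  · rw [h0, div_zero]
    obtain ⟨m, hm⟩ := (Complex.Gamma_eq_zero_iff α).1 h0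
    refine tendsto_const_nhds.congr' ?_
    filter_upwards [eventually_gt_atTop m] with n hn
    rw [normNegBinom, negBinom, Finset.prod_eq_zero (i := m) (by simpa using hn) (by simp [hm])]
    simp
  · have := ((Complex.GammaSeq_tendsto_Gamma α).inv₀ h0).mul h1
    rw [mul_one, ← one_div] at this
    exact this.congr' (hkey.mono fun n hn => hn.symm)

/-- Second order bound for the ratio of consecutive normalised coefficients. -/
theorem norm_one_add_mul_exp_sub_one_le {B : ℝ} {β : ℂ} (hβ : ‖β‖ ≤ B) {x : ℝ}
    (hx0 : 0 ≤ x) (hx : x ≤ 1 / 2) :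
    ‖(1 + β * x) * Complex.exp (β * Real.log (1 - x)) - 1‖ ≤
      ((1 + B) * (4 * B ^ 2 * Real.exp B) + 2 * B + 2 * B ^ 2) * x ^ 2 := by
  have hB : 0 ≤ B := (norm_nonneg _).trans hβ
  set l := Real.log (1 - x)
  have h1 : |x + l| ≤ 2 * x ^ 2 := by
    have := Real.abs_log_sub_add_sum_range_le (x := x) (by rw [abs_of_nonneg hx0]; linarith) 1
    simp only [Finset.range_one, Finset.sum_singleton, abs_of_nonneg hx0] at this
    norm_num at this
    refine this.trans ?_
    rw [div_le_iff₀ (by linarith)]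
    nlinarith [sq_nonneg x]
  have h2 : |l| ≤ 2 * x := by
    have := abs_sub (x + l) x
    rw [add_sub_cancel_left, abs_of_nonneg hx0] at this
    nlinarith
  set u : ℂ := β * l with hu
  have hun : ‖u‖ ≤ B * (2 * x) := by
    rw [hu, norm_mul, Complex.norm_real, Real.norm_eq_abs]
    gcongr
  have hun2 : ‖u‖ ≤ B := hun.trans (by nlinarith)
  have h3 : ‖Complex.exp u - 1 - u‖ ≤ (B * (2 * x)) ^ 2 * Real.exp B := by
    have := Complex.norm_exp_sub_sum_le_norm_mul_exp u 2
    simp only [Finset.sum_range_succ, Finset.range_zero, Finset.sum_empty, pow_zero, pow_one,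
      Nat.factorial, Nat.cast_one, div_one, zero_add, mul_one] at this
    rw [← sub_sub] at this
    refine this.trans ?_
    gcongr
  have h4 : ‖(1 : ℂ) + β * x‖ ≤ 1 + B := by
    refine (norm_add_le _ _).trans ?_
    rw [norm_one, norm_mul, Complex.norm_real, Real.norm_of_nonneg hx0]
    nlinarith
  have h5 : ‖β * (x + l : ℝ)‖ ≤ B * (2 * x ^ 2) := by
    rw [norm_mul, Complex.norm_real, Real.norm_eq_abs]
    gcongr
  have h6 : ‖β * x * u‖ ≤ B * x * (B * (2 * x)) := by
    rw [norm_mul, norm_mul, Complex.norm_real, Real.norm_of_nonneg hx0]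
    gcongr
  have e : (1 + β * x) * Complex.exp u - 1 =
      (1 + β * x) * (Complex.exp u - 1 - u) + β * (x + l : ℝ) + β * x * u := by
    rw [hu]; push_cast; ring
  rw [e]
  calc _ ≤ ‖(1 + β * x) * (Complex.exp u - 1 - u)‖ + ‖β * (x + l : ℝ)‖ + ‖β * x * u‖ :=
        norm_add₃_le
    _ ≤ (1 + B) * ((B * (2 * x)) ^ 2 * Real.exp B) + B * (2 * x ^ 2) + B * x * (B * (2 * x)) := by
        rw [norm_mul]
        gcongr
    _ = _ := by ring

theorem normNegBinom_succ (α : ℂ) {n : ℕ} (hn : 1 ≤ n) :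
    normNegBinom α (n + 1) = normNegBinom α n *
      ((1 + (α - 1) * ((1 / (n + 1) : ℝ) : ℂ)) *
        Complex.exp ((α - 1) * Real.log (1 - 1 / (n + 1)))) := by
  have hn0 : (0 : ℝ) < n := by exact_mod_cast hn
  have hnc : (n : ℂ) ≠ 0 := by exact_mod_cast (by omega : n ≠ 0)
  have hnc1 : (n + 1 : ℂ) ≠ 0 := by exact_mod_cast n.succ_ne_zero
  have h1 : Real.log (1 - 1 / (n + 1)) = Real.log n - Real.log (n + 1) := by
    rw [← Real.log_div hn0.ne' (by positivity)]
    congr 1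
    field_simp
    ring
  have h2 : Complex.exp ((α - 1) * Real.log (1 - 1 / (n + 1))) =
      Complex.exp (α * Real.log n) * Complex.exp (-α * Real.log (n + 1)) * ((n + 1) / n) := by
    have e1 : Complex.exp (Real.log n) = n := by
      rw [← Complex.ofReal_exp, Real.exp_log hn0]; simp
    have e2 : Complex.exp (Real.log (n + 1)) = n + 1 := by
      rw [← Complex.ofReal_exp, Real.exp_log (by positivity)]; simp
    have e3 : ((n + 1) / n : ℂ) = Complex.exp (Real.log (n + 1) - Real.log n) := by
      rw [Complex.exp_sub, e1, e2]
    rw [e3, ← Complex.exp_add, ← Complex.exp_add, h1]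
    congr 1
    push_cast
    ring
  have h3 : negBinom α (n + 1) = negBinom α n * ((α + n) / (n + 1)) := by
    rw [negBinom, Finset.prod_range_succ, ← negBinom]
  have h4 : Complex.exp (-α * Real.log n) * Complex.exp (α * Real.log n) = 1 := by
    rw [← Complex.exp_add]; simp
  have h5 : (1 + (α - 1) * ((1 / (n + 1) : ℝ) : ℂ) : ℂ) = (α + n) / (n + 1) := by
    push_cast; field_simp; ring
  rw [h2, normNegBinom, normNegBinom, h3, h5]
  rw [Nat.cast_succ, Nat.cast_succ]
  generalize Complex.exp (-α * Real.log n) = E1 at *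
  generalize Complex.exp (α * Real.log n) = E2 at *
  generalize Complex.exp (-α * Real.log (n + 1)) = E3 at *
  field_simp
  linear_combination (-E3 * negBinom α n * (α + n)) * h4

/-- The ratio of consecutive terms is 1 + O(k^{-2}) uniformly on the ball, so the sequence is α
times partial products converging uniformly. The limit is identified by pointwise convergence. -/
theorem tendstoUniformlyOn_normNegBinom (B : ℝ) :
    TendstoUniformlyOn (fun n α => normNegBinom α n) (fun α => 1 / Complex.Gamma α) atTop
      (Metric.closedBall 0 B) := by
  set f : ℕ → ℂ → ℂ := fun k α => (1 + (α - 1) * ((1 / ((k + 1 : ℕ) + 1) : ℝ) : ℂ)) *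
        Complex.exp ((α - 1) * Real.log (1 - 1 / ((k + 1 : ℕ) + 1))) - 1 with hf
  have hprod : ∀ α (n : ℕ), normNegBinom α (n + 1) = α * ∏ k ∈ Finset.range n, (1 + f k α) := by
    intro α n
    induction n with
    | zero => simp [normNegBinom, negBinom]
    | succ n ih =>
      rw [normNegBinom_succ α (by omega), ih, Finset.prod_range_succ, hf]
      ring
  set D := ((1 + (B + 1)) * (4 * (B + 1) ^ 2 * Real.exp (B + 1)) + 2 * (B + 1) + 2 * (B + 1) ^ 2)
  have hsum : Summable fun k : ℕ => D * (1 / ((k + 1 : ℕ) + 1) : ℝ) ^ 2 := by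
    refine Summable.mul_left _ ?_
    have h := (summable_nat_add_iff 2).2 (Real.summable_one_div_nat_pow.2 (by norm_num : 1 < 2))
    refine h.congr fun k => ?_
    push_cast
    rw [one_div_pow]
    ring_nf
  have hb : ∀ k α, α ∈ Metric.closedBall (0 : ℂ) B →
      ‖f k α‖ ≤ D * (1 / ((k + 1 : ℕ) + 1) : ℝ) ^ 2 := by
    intro k α hα
    rw [mem_closedBall_zero_iff] at hα
    refine norm_one_add_mul_exp_sub_one_le ?_ (by positivity) ?_
    · exact (norm_sub_le _ _).trans (by simpa using hα)
    · rw [div_le_div_iff₀ (by positivity) (by norm_num)]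
      push_cast
      linarith [(Nat.cast_nonneg k : (0 : ℝ) ≤ k)]
  have h1 := Summable.hasProdUniformlyOn_nat_one_add (isCompact_closedBall (0 : ℂ) B) hsum
    (Eventually.of_forall fun k α hα => hb k α hα) (fun k => by
      simp only [hf]
      fun_prop)
  have h2 := h1.tendstoUniformlyOn_finsetRange
  set g : ℂ → ℂ := fun x => ∏' i, (1 + f i x)
  have hlim : ∀ α ∈ Metric.closedBall (0 : ℂ) B, 1 / Complex.Gamma α = α * g α := by
    intro α hα
    have t1 := (tendsto_add_atTop_iff_nat 1).2 (tendsto_normNegBinom α)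
    simp only [hprod] at t1
    exact tendsto_nhds_unique t1 ((h2.tendsto_at hα).const_mul α)
  rw [Metric.tendstoUniformlyOn_iff] at h2 ⊢
  intro ε hε
  have hB1 : 0 < |B| + 1 := by positivity
  obtain ⟨N, hN⟩ := eventually_atTop.1 (h2 (ε / (|B| + 1)) (by positivity))
  filter_upwards [eventually_ge_atTop (N + 1)] with n hn α hα
  obtain ⟨k, rfl⟩ : ∃ k, n = k + 1 := ⟨n - 1, by omega⟩
  have h3 := hN k (by omega) α hα
  rw [lt_div_iff₀ hB1] at h3
  rw [hlim α hα, hprod, dist_eq_norm, ← mul_sub, norm_mul]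
  rw [dist_eq_norm] at h3
  rw [mem_closedBall_zero_iff] at hα
  have h4 : ‖α‖ ≤ |B| + 1 := by linarith [le_abs_self B]
  calc _ ≤ (|B| + 1) * ‖g α - ∏ i ∈ Finset.range k, (1 + f i α)‖ := by gcongr
    _ < ε := by rw [mul_comm]; exact h3

/-! ### Pointwise bounds for the remainder near and far from the singularity. -/

/-- The polynomial `∑_{m ∈ D} (a_m / m) t ^ m` at complex arguments. -/
noncomputable def cycPoly (a : ℕ → ℝ) (D : Finset ℕ) (t : ℂ) : ℂ :=
  ∑ m ∈ D, ((a m / m : ℝ) : ℂ) * t ^ m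

/-- The value at `1` of `cycPoly`. -/
noncomputable def cycSum (a : ℕ → ℝ) (D : Finset ℕ) : ℝ := ∑ m ∈ D, a m / m

/-- The difference between the generating function and its model at the singularity. -/
noncomputable def remainder (a : ℕ → ℝ) (ϑ K : ℝ) (G : ℂ → ℂ) (D : Finset ℕ) (w t : ℂ) : ℂ :=
  Complex.exp (w * (G t - cycPoly a D t)) -
    Complex.exp (w * (K - cycSum a D)) * Complex.exp (-(w * ϑ) * Complex.log (1 - t))

theorem cycSum_nonneg {a : ℕ → ℝ} (ha : ∀ m, 1 ≤ m → 0 ≤ a m) {D : Finset ℕ} {d : ℕ}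
    (hD : D ⊆ Finset.Icc 1 d) : 0 ≤ cycSum a D :=
  Finset.sum_nonneg fun m hm =>
    div_nonneg (ha m (Finset.mem_Icc.1 (hD hm)).1) (Nat.cast_nonneg m)

theorem cycSum_le {a : ℕ → ℝ} (ha : ∀ m, 1 ≤ m → 0 ≤ a m) {D : Finset ℕ} {d : ℕ}
    (hD : D ⊆ Finset.Icc 1 d) : cycSum a D ≤ ∑ m ∈ Finset.Icc 1 d, a m / m :=
  Finset.sum_le_sum_of_subset_of_nonneg hD fun m hm _ =>
    div_nonneg (ha m (Finset.mem_Icc.1 hm).1) (Nat.cast_nonneg m)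

theorem norm_cycPoly_le {a : ℕ → ℝ} (ha : ∀ m, 1 ≤ m → 0 ≤ a m) {D : Finset ℕ} {d : ℕ}
    (hD : D ⊆ Finset.Icc 1 d) {t : ℂ} (ht : ∀ m ≤ d, ‖t‖ ^ m ≤ Real.exp 1) :
    ‖cycPoly a D t‖ ≤ Real.exp 1 * cycSum a D := by
  rw [cycSum, Finset.mul_sum]
  refine norm_sum_le_of_le _ fun m hm => ?_
  have hm' := Finset.mem_Icc.1 (hD hm)
  have h0 : 0 ≤ a m / m := div_nonneg (ha m hm'.1) (Nat.cast_nonneg m)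
  rw [norm_mul, Complex.norm_real, Real.norm_of_nonneg h0, norm_pow, mul_comm]
  exact mul_le_mul_of_nonneg_right (ht m hm'.2) h0

/-- Factor t^m - 1 = (t - 1) ∑_{k<m} t^k; the factor m cancels the denominator of a_m / m. -/
theorem norm_cycPoly_sub_le {a : ℕ → ℝ} (ha : ∀ m, 1 ≤ m → 0 ≤ a m) {D : Finset ℕ} {d : ℕ}
    (hD : D ⊆ Finset.Icc 1 d) {t : ℂ} (ht : ∀ m ≤ d, ‖t‖ ^ m ≤ Real.exp 1) :
    ‖cycPoly a D t - cycSum a D‖ ≤ Real.exp 1 * (∑ m ∈ Finset.Icc 1 d, a m) * ‖t - 1‖ := by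
  have h1 : cycPoly a D t - cycSum a D = ∑ m ∈ D, ((a m / m : ℝ) : ℂ) * (t ^ m - 1) := by
    simp only [cycPoly, cycSum, mul_sub, mul_one, Finset.sum_sub_distrib, Complex.ofReal_sum]
  have h2 : ∑ m ∈ D, a m ≤ ∑ m ∈ Finset.Icc 1 d, a m :=
    Finset.sum_le_sum_of_subset_of_nonneg hD fun m hm _ => ha m (Finset.mem_Icc.1 hm).1
  have h3 : ‖∑ m ∈ D, ((a m / m : ℝ) : ℂ) * (t ^ m - 1)‖ ≤
      ∑ m ∈ D, Real.exp 1 * a m * ‖t - 1‖ := by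
    refine norm_sum_le_of_le _ fun m hm => ?_
    have hm' := Finset.mem_Icc.1 (hD hm)
    have hm0 : (0 : ℝ) < m := by exact_mod_cast hm'.1
    have h0 : 0 ≤ a m / m := div_nonneg (ha m hm'.1) (Nat.cast_nonneg m)
    have h4 : ‖t ^ m - 1‖ ≤ m * Real.exp 1 * ‖t - 1‖ := by
      rw [← geom_sum_mul, norm_mul]
      refine mul_le_mul_of_nonneg_right ?_ (norm_nonneg _)
      calc _ ≤ ∑ k ∈ Finset.range m, Real.exp 1 := norm_sum_le_of_le _ fun k hk => by
            rw [norm_pow]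
            exact ht k (by have := Finset.mem_range.1 hk; omega)
        _ = _ := by simp
    rw [norm_mul, Complex.norm_real, Real.norm_of_nonneg h0]
    calc _ ≤ a m / m * (m * Real.exp 1 * ‖t - 1‖) := mul_le_mul_of_nonneg_left h4 h0
      _ = _ := by field_simp
  rw [h1]
  refine h3.trans ?_
  rw [← Finset.sum_mul, ← Finset.mul_sum]
  gcongr

theorem norm_exp_neg_mul_log_le {w : ℂ} (hw : ‖w‖ = 1) {ϑ : ℝ} (hϑ : 0 < ϑ) (z : ℂ) :
    ‖Complex.exp (-(w * ϑ) * Complex.log z)‖ ≤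
      Real.exp (-(ϑ * (w.re * Real.log ‖z‖))) * Real.exp (ϑ * Real.pi) := by
  rw [Complex.norm_exp, ← Real.exp_add]
  refine Real.exp_le_exp.2 ?_
  have h1 : w.im * z.arg ≤ Real.pi := by
    refine (le_abs_self _).trans ?_
    rw [abs_mul]
    calc _ ≤ 1 * Real.pi := mul_le_mul ((Complex.abs_im_le_norm w).trans hw.le)
          (Complex.abs_arg_le_pi z) (abs_nonneg _) zero_le_one
      _ = _ := one_mul _
  have h2 : (-(w * ϑ) * Complex.log z).re = -(ϑ * (w.re * Real.log ‖z‖)) + ϑ * (w.im * z.arg) := by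
    simp [Complex.log_re, Complex.log_im]
    ring
  rw [h2]
  nlinarith

section LogSingular

variable {a : ℕ → ℝ} {ϑ K R φ : ℝ} {G : ℂ → ℂ} {ε C : ℝ}

theorem LogSingular.differentiableOn_log (h : LogSingular a ϑ K R φ G ε C) :
    DifferentiableOn ℂ (fun t => Complex.log (1 - t)) (Delta 1 R φ) := fun _ ht =>
  ((differentiableAt_const (1 : ℂ)).sub differentiableAt_id).clog
    (one_sub_mem_slitPlane h.pos ht) |>.differentiableWithinAt

theorem LogSingular.differentiableOn_remainder (h : LogSingular a ϑ K R φ G ε C)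
    (D : Finset ℕ) (w : ℂ) : DifferentiableOn ℂ (remainder a ϑ K G D w) (Delta 1 R φ) := by
  have h1 : DifferentiableOn ℂ (cycPoly a D) (Delta 1 R φ) := by
    unfold cycPoly
    fun_prop
  have h2 := h.differentiableOn
  have h3 := h.differentiableOn_log
  unfold remainder
  fun_prop

/-- The remainder is the model times e^{wq} - 1, where q collects the error of the expansion of G
and the variation of the polynomial between t and 1. Hence |wq| ≤ X and |e^{wq} - 1| ≤ X e^X. -/
theorem LogSingular.norm_remainder_near_le (h : LogSingular a ϑ K R φ G ε C)
    (ha : ∀ m, 1 ≤ m → 0 ≤ a m) (hϑ : 0 < ϑ) {D : Finset ℕ} {d : ℕ}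
    (hD : D ⊆ Finset.Icc 1 d) {t : ℂ} (htΔ : t ∈ Delta 1 R φ) (htε : ‖t - 1‖ < ε)
    (ht : ∀ m ≤ d, ‖t‖ ^ m ≤ Real.exp 1) {w : ℂ} (hw : ‖w‖ = 1) {X : ℝ}
    (hX : (C + Real.exp 1 * ∑ m ∈ Finset.Icc 1 d, a m) * ‖t - 1‖ ≤ X) :
    ‖remainder a ϑ K G D w t‖ ≤ Real.exp (w.re * (K - cycSum a D)) *
      (Real.exp (-(ϑ * (w.re * Real.log ‖1 - t‖))) * Real.exp (ϑ * Real.pi)) *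
        (X * Real.exp X) := by
  set q : ℂ := (G t - (-(ϑ : ℂ) * Complex.log (1 - t) + K)) - (cycPoly a D t - cycSum a D) with hq
  have hqX : ‖w * q‖ ≤ X := by
    rw [norm_mul, hw, one_mul]
    refine (norm_sub_le _ _).trans (le_trans ?_ hX)
    rw [add_mul]
    exact add_le_add (h.near t htΔ htε) (norm_cycPoly_sub_le ha hD ht)
  have e : remainder a ϑ K G D w t = Complex.exp (w * (K - cycSum a D)) *
      Complex.exp (-(w * ϑ) * Complex.log (1 - t)) * (Complex.exp (w * q) - 1) := by
    have e1 : Complex.exp (w * (G t - cycPoly a D t)) = Complex.exp (w * (K - cycSum a D)) *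
        Complex.exp (-(w * ϑ) * Complex.log (1 - t)) * Complex.exp (w * q) := by
      rw [← Complex.exp_add, ← Complex.exp_add]
      congr 1
      rw [hq]; ring
    rw [remainder, e1]
    ring
  have h1 : ‖Complex.exp (w * (K - cycSum a D))‖ = Real.exp (w.re * (K - cycSum a D)) := by
    rw [Complex.norm_exp]
    congr 1
    rw [← Complex.ofReal_sub]
    simp
  have h2 : ‖Complex.exp (w * q) - 1‖ ≤ X * Real.exp X := by
    have := Complex.norm_exp_sub_sum_le_norm_mul_exp (w * q) 1
    simp only [Finset.sum_range_succ, Finset.range_zero, Finset.sum_empty, pow_zero, pow_one,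
      Nat.factorial, Nat.cast_one, div_one, zero_add] at this
    have hX0 : 0 ≤ X := (norm_nonneg _).trans hqX
    exact this.trans (by gcongr)
  rw [e, norm_mul, norm_mul, h1]
  gcongr
  exact norm_exp_neg_mul_log_le hw hϑ _

theorem norm_log_le (z : ℂ) : ‖Complex.log z‖ ≤ |Real.log ‖z‖| + Real.pi := by
  have := Complex.norm_le_abs_re_add_abs_im (Complex.log z)
  rw [Complex.log_re, Complex.log_im] at this
  linarith [Complex.abs_arg_le_pi z]

/-- A point with |arg(t - 1)| ≤ φ < π/2 has Re(t - 1) ≥ 0, hence |t|² = 1 + 2 Re(t - 1) + |t - 1|² ≥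
1 + ε². -/
theorem mem_Delta_of_norm_sq_lt {R φ ε : ℝ} (h1 : φ < Real.pi / 2) (hε : 0 < ε)
    {t : ℂ} (htR : ‖t‖ < R) (ht : ‖t‖ ^ 2 < 1 + ε ^ 2) (htε : ε ≤ ‖t - 1‖) : t ∈ Delta 1 R φ := by
  have hε' : t ≠ 1 := by
    rintro rfl
    simp at htε
    linarith
  refine ⟨htR, by simpa using hε', ?_⟩
  by_contra! hle
  have hre := (Complex.abs_arg_le_pi_div_two_iff).1 (hle.trans h1.le)
  simp only [Complex.ofReal_one, Complex.sub_re, Complex.one_re] at hre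
  rw [Complex.sq_norm, Complex.normSq_apply] at ht
  have h2 : ε ^ 2 ≤ ‖t - 1‖ ^ 2 := by gcongr
  rw [Complex.sq_norm, Complex.normSq_apply] at h2
  simp only [Complex.sub_re, Complex.one_re, Complex.sub_im, Complex.one_im, sub_zero] at h2
  nlinarith

/-- On |t| = e^δ one has |1 - t| ≥ e^δ - 1 ≥ δ. Within ε of 1 the expansion of G applies; elsewhere
G is bounded on a compact set that does not depend on δ. -/
theorem LogSingular.exists_far_bound (h : LogSingular a ϑ K R φ G ε C) (hϑ : 0 < ϑ) :
    ∃ δ₁ M : ℝ, 0 < δ₁ ∧ ∀ δ : ℝ, 0 < δ → δ ≤ δ₁ → ∀ t ∈ Delta 1 R φ, ‖t‖ = Real.exp δ →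
      ‖G t‖ ≤ ϑ * (-Real.log δ) + M ∧ ‖Complex.log (1 - t)‖ ≤ -Real.log δ + M := by
  have hε := h.ε_pos
  have hlR : 0 < Real.log R := Real.log_pos h.one_lt
  have hlε : 0 < Real.log (1 + ε ^ 2) := Real.log_pos (by nlinarith [sq_pos_of_pos hε])
  set δ₁ := min 1 (min (Real.log (1 + ε ^ 2) / 3) (Real.log R / 2))
  have d0 : 0 < δ₁ := by positivity
  have d1 : δ₁ ≤ 1 := min_le_left _ _
  have d2 : δ₁ ≤ Real.log (1 + ε ^ 2) / 3 := (min_le_right _ _).trans (min_le_left _ _)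
  have d3 : δ₁ ≤ Real.log R / 2 := (min_le_right _ _).trans (min_le_right _ _)
  have r1 : Real.exp δ₁ < R := by
    rw [← Real.lt_log_iff_exp_lt (by linarith [h.one_lt])]; linarith
  have r2 : Real.exp δ₁ ^ 2 < 1 + ε ^ 2 := by
    rw [← Real.exp_nat_mul, ← Real.lt_log_iff_exp_lt (by positivity)]
    push_cast
    linarith
  set S : Set ℂ := Metric.closedBall 0 (Real.exp δ₁) ∩ {t : ℂ | ε ≤ ‖t - 1‖}
  have hSc : IsCompact S :=
    (isCompact_closedBall (0 : ℂ) _).inter_right (isClosed_le (by fun_prop) (by fun_prop))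
  have hSΔ : S ⊆ Delta 1 R φ := by
    rintro t ⟨t1, t2⟩
    rw [mem_closedBall_zero_iff] at t1
    refine mem_Delta_of_norm_sq_lt h.lt_half_pi hε (t1.trans_lt r1) ?_ t2
    exact (pow_le_pow_left₀ (norm_nonneg _) t1 2).trans_lt r2
  obtain ⟨M₀, hM₀⟩ := hSc.exists_bound_of_continuousOn (h.differentiableOn.continuousOn.mono hSΔ)
  have hl4 : 0 ≤ Real.log 4 := Real.log_nonneg (by norm_num)
  have hC := h.C_pos
  refine ⟨δ₁, max (|M₀|) (max (Real.log 4 + Real.pi)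
    (ϑ * (Real.log 4 + Real.pi) + |K| + C * ε)), d0, fun δ hδ hδ1 t ht htn => ?_⟩
  set M := max (|M₀|) (max (Real.log 4 + Real.pi) (ϑ * (Real.log 4 + Real.pi) + |K| + C * ε))
  have m1 : |M₀| ≤ M := by simp [M]
  have m2 : Real.log 4 + Real.pi ≤ M := by simp [M]
  have m3 : ϑ * (Real.log 4 + Real.pi) + |K| + C * ε ≤ M := by simp [M]
  have hlδ : 0 ≤ -Real.log δ := by
    rw [Left.nonneg_neg_iff]
    exact Real.log_nonpos hδ.le (hδ1.trans d1)
  have hlog : ‖Complex.log (1 - t)‖ ≤ -Real.log δ + (Real.log 4 + Real.pi) := by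
    refine (norm_log_le _).trans ?_
    have l1 : δ ≤ ‖1 - t‖ := by
      have e1 := norm_sub_norm_le t 1
      rw [norm_one, htn, norm_sub_rev] at e1
      linarith [Real.add_one_le_exp δ]
    have l2 : ‖1 - t‖ ≤ 4 := by
      have e1 := norm_sub_le 1 t
      rw [norm_one, htn] at e1
      have : Real.exp δ ≤ Real.exp 1 := Real.exp_le_exp.2 (hδ1.trans d1)
      linarith [Real.exp_one_lt_d9]
    have l3 := Real.log_le_log hδ l1
    have l4 := Real.log_le_log (hδ.trans_le l1) l2
    have : |Real.log ‖1 - t‖| ≤ -Real.log δ + Real.log 4 := abs_le.2 ⟨by linarith, by linarith⟩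
    linarith
  refine ⟨?_, hlog.trans (by linarith)⟩
  rcases lt_or_ge ‖t - 1‖ ε with hn | hn
  · have h1 := h.near t ht hn
    have h2 : ‖G t‖ ≤ ‖G t - (-(ϑ : ℂ) * Complex.log (1 - t) + K)‖ +
        (‖-(ϑ : ℂ) * Complex.log (1 - t)‖ + ‖(K : ℂ)‖) := by
      have := norm_add_le (G t - (-(ϑ : ℂ) * Complex.log (1 - t) + K))
        (-(ϑ : ℂ) * Complex.log (1 - t) + K)
      rw [sub_add_cancel] at this
      exact this.trans (add_le_add_right (norm_add_le _ _) _)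
    rw [norm_mul, norm_neg, Complex.norm_real, Complex.norm_real, Real.norm_of_nonneg hϑ.le,
      Real.norm_eq_abs] at h2
    have h3 := mul_le_mul_of_nonneg_left hlog hϑ.le
    have h4 : C * ‖t - 1‖ ≤ C * ε := by gcongr
    linarith
  · have : t ∈ S := by
      refine ⟨?_, hn⟩
      rw [mem_closedBall_zero_iff, htn]
      exact Real.exp_le_exp.2 hδ1
    have h1 := hM₀ t this
    have h2 := le_abs_self M₀
    have h3 : 0 ≤ ϑ * (-Real.log δ) := by positivity
    linarith

/-- Both exponentials are bounded crudely through the norms of their exponents: a power loss is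
affordable, since the far arc carries an exponentially small factor. -/
theorem LogSingular.norm_remainder_far_le (ha : ∀ m, 1 ≤ m → 0 ≤ a m) (hϑ : 0 < ϑ)
    {D : Finset ℕ} {d : ℕ} (hD : D ⊆ Finset.Icc 1 d) {t : ℂ}
    (ht : ∀ m ≤ d, ‖t‖ ^ m ≤ Real.exp 1) {w : ℂ} (hw : ‖w‖ = 1) {ℓ M : ℝ}
    (hG : ‖G t‖ ≤ ϑ * ℓ + M) (hlog : ‖Complex.log (1 - t)‖ ≤ ℓ + M) :
    ‖remainder a ϑ K G D w t‖ ≤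
      2 * Real.exp (ϑ * ℓ + (1 + ϑ) * |M| + |K| + Real.exp 1 * cycSum a D) := by
  have hS := cycSum_nonneg ha hD
  have he : 1 ≤ Real.exp 1 := Real.one_le_exp (by norm_num)
  have hM := le_abs_self M
  rw [remainder, two_mul]
  refine (norm_sub_le _ _).trans (add_le_add ?_ ?_)
  · refine (Complex.norm_exp_le_exp_norm _).trans (Real.exp_le_exp.2 ?_)
    rw [norm_mul, hw, one_mul]
    have := (norm_sub_le (G t) (cycPoly a D t)).trans (add_le_add hG (norm_cycPoly_le ha hD ht))
    have h2 : 0 ≤ ϑ * |M| + |K| := by positivity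
    linarith
  · rw [← Complex.exp_add]
    refine (Complex.norm_exp_le_exp_norm _).trans (Real.exp_le_exp.2 ?_)
    refine (norm_add_le _ _).trans ?_
    rw [norm_mul, norm_mul, norm_neg, norm_mul, hw, one_mul, one_mul, Complex.norm_real,
      Real.norm_of_nonneg hϑ.le]
    have h1 : ‖(K : ℂ) - cycSum a D‖ ≤ |K| + cycSum a D := by
      refine (norm_sub_le _ _).trans ?_
      rw [Complex.norm_real, Complex.norm_real, Real.norm_of_nonneg hS, Real.norm_eq_abs]
    have h2 := mul_le_mul_of_nonneg_left hlog hϑ.le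
    have h3 : ϑ * M ≤ ϑ * |M| := by gcongr
    have h4 : cycSum a D ≤ Real.exp 1 * cycSum a D := by nlinarith
    have h5 := abs_nonneg M
    linarith

end LogSingular

/-! ### The n-th coefficient of the remainder. -/

/-- The exponent v satisfies |v|² = s² + η² - 2sη cos φ ≥ (1 - cos φ)/2 · (s + η)², and |e^v - 1 -
v| ≤ |v|² ≤ |v|/2. -/
theorem norm_exp_sub_one_bounds {φ : ℝ} (h0 : 0 < φ) (h1 : φ < Real.pi / 2) :
    ∃ κ : ℝ, 0 < κ ∧ κ ≤ 1 ∧ ∀ η s : ℝ, 0 < η → 0 ≤ s → s + η ≤ 1 / 2 →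
      κ * (s + η) ≤ ‖Complex.exp ((-η : ℝ) + s * Complex.exp (φ * Complex.I)) - 1‖ ∧
      ‖Complex.exp ((-η : ℝ) + s * Complex.exp (φ * Complex.I)) - 1‖ ≤ 2 * (s + η) := by
  have hc1 : Real.cos φ < 1 := by
    rw [← Real.cos_zero]
    exact Real.cos_lt_cos_of_nonneg_of_le_pi le_rfl (by linarith [Real.pi_pos]) h0
  have hc0 : 0 < Real.cos φ := Real.cos_pos_of_mem_Ioo ⟨by linarith, h1⟩
  set k := Real.sqrt ((1 - Real.cos φ) / 2)
  have hk2 : k ^ 2 = (1 - Real.cos φ) / 2 := Real.sq_sqrt (by linarith)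
  have hk0 : 0 < k := Real.sqrt_pos.2 (by linarith)
  have hk1 : k ≤ 1 := by
    by_contra! hlt
    nlinarith
  refine ⟨k / 2, by positivity, by linarith, fun η s hη hs hsum => ?_⟩
  set v : ℂ := (-η : ℝ) + s * Complex.exp (φ * Complex.I) with hv
  have hup : ‖v‖ ≤ s + η := by
    refine (norm_add_le _ _).trans ?_
    rw [norm_mul, Complex.norm_exp_ofReal_mul_I, Complex.norm_real, Complex.norm_real,
      norm_neg, Real.norm_of_nonneg hη.le, Real.norm_of_nonneg hs]
    linarith
  have hsq : ‖v‖ ^ 2 = (s * Real.cos φ - η) ^ 2 + (s * Real.sin φ) ^ 2 := by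
    rw [Complex.sq_norm, Complex.normSq_apply, hv, Complex.exp_mul_I, ← Complex.ofReal_cos,
      ← Complex.ofReal_sin]
    simp [-Complex.ofReal_cos, -Complex.ofReal_sin]
    ring
  have hlow : k * (s + η) ≤ ‖v‖ := by
    refine le_of_sq_le_sq ?_ (norm_nonneg _)
    rw [hsq, mul_pow, hk2]
    have e : (s * Real.cos φ - η) ^ 2 + (s * Real.sin φ) ^ 2 =
        s ^ 2 + η ^ 2 - 2 * s * η * Real.cos φ := by
      have := Real.sin_sq_add_cos_sq φ
      linear_combination s ^ 2 * this
    rw [e]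
    nlinarith [mul_nonneg (sq_nonneg (s - η)) (by linarith : 0 ≤ 1 + Real.cos φ)]
  have hsm := Complex.norm_exp_sub_one_sub_id_le (x := v) (by linarith)
  have hv2 : ‖v‖ ^ 2 ≤ ‖v‖ / 2 := by nlinarith [norm_nonneg v]
  constructor
  · have := norm_sub_norm_le v (-(Complex.exp v - 1 - v))
    rw [norm_neg, show v - -(Complex.exp v - 1 - v) = Complex.exp v - 1 by ring] at this
    linarith
  · have := norm_add_le (Complex.exp v - 1 - v) v
    rw [sub_add_cancel] at this
    linarith

theorem integral_exp_neg_mul_le {μ l : ℝ} (hμ : 0 < μ) :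
    ∫ s in (0 : ℝ)..l, Real.exp (-(μ * s)) ≤ 1 / μ := by
  have hd : ∀ s : ℝ, HasDerivAt (fun s => -(1 / μ) * Real.exp (-(μ * s))) (Real.exp (-(μ * s))) s := by
    intro s
    have := (((hasDerivAt_id s).const_mul μ).neg.exp).const_mul (-(1 / μ))
    refine this.congr_deriv ?_
    simp
    field_simp
  rw [intervalIntegral.integral_eq_sub_of_hasDerivAt (fun s _ => hd s)
    (by apply Continuous.intervalIntegrable; fun_prop)]
  have : 0 ≤ 1 / μ * Real.exp (-(μ * l)) := by positivity
  simp
  simp at this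
  linarith

/-- Serves to absorb a power of 1 + ns into half of the exponential decay along the ray. -/
theorem exists_mul_log_one_add_le {p μ : ℝ} (hp : 0 < p) (hμ : 0 < μ) :
    ∃ A : ℝ, ∀ u : ℝ, 0 ≤ u → p * Real.log (1 + u) ≤ μ * u + A := by
  refine ⟨μ - p * (1 + Real.log (μ / p)), fun u hu => ?_⟩
  have h1 : 0 < μ / p := by positivity
  have h2 := Real.log_le_sub_one_of_pos (x := μ / p * (1 + u)) (by positivity)
  rw [Real.log_mul h1.ne' (by positivity)] at h2
  have h3 := mul_le_mul_of_nonneg_left h2 hp.le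
  have h4 : p * (μ / p * (1 + u) - 1) = μ * (1 + u) - p := by field_simp
  rw [h4] at h3
  linarith

theorem LogSingular.exists_partial_sum_le {a : ℕ → ℝ} {ϑ K R φ : ℝ} {G : ℂ → ℂ} {ε C : ℝ}
    (h : LogSingular a ϑ K R φ G ε C) (ha : ∀ m, 1 ≤ m → 0 ≤ a m) (hϑ : 0 < ϑ) :
    ∃ B : ℝ, 0 < B ∧ ∀ d : ℕ, 1 ≤ d → ∑ m ∈ Finset.Icc 1 d, a m ≤ B * d ∧
      ∑ m ∈ Finset.Icc 1 d, a m / m ≤ ϑ * Real.log d + B := by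
  have hε := h.ε_pos
  have hC := h.C_pos
  have hball := ball_subset_Delta h.one_lt h.lt_half_pi
  have hreal : ∀ x : ℝ, 0 ≤ x → x < 1 → HasSum (fun m : ℕ => a m / m * x ^ m) (G x).re := by
    intro x h0 h1
    have h2 := Complex.hasSum_re (h.hasSum x (by rwa [Complex.norm_real, Real.norm_of_nonneg h0]))
    have e : (fun m : ℕ => (((a m / m : ℝ) : ℂ) * (x : ℂ) ^ m).re) =
        fun m : ℕ => a m / m * x ^ m := by
      funext m
      rw [← Complex.ofReal_pow, ← Complex.ofReal_mul, Complex.ofReal_re]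
    rwa [e] at h2
  refine WeightedPerm.exists_partial_sum_le ha hϑ (g := fun x => (G x).re) hreal
    (ε := min ε 1) (C := |K| + C * ε) (by positivity) fun x hx hx1 => ?_
  have hx0 : 0 < x := by linarith [min_le_right ε 1]
  have hn : ‖(x : ℂ) - 1‖ = 1 - x := by
    rw [← Complex.ofReal_one, ← Complex.ofReal_sub, Complex.norm_real, Real.norm_eq_abs, abs_sub_comm,
      abs_of_pos (by linarith)]
  have hxε : 1 - x < ε := by linarith [min_le_left ε 1]
  have h1 := h.near x (hball (by
    rw [mem_ball_zero_iff, Complex.norm_real, Real.norm_of_nonneg hx0.le]; exact hx1))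
    (by rw [hn]; exact hxε)
  rw [hn] at h1
  have h2 := (Complex.abs_re_le_norm _).trans h1
  have e : (G x - (-(ϑ : ℂ) * Complex.log (1 - x) + K)).re = ((G x).re + ϑ * Real.log (1 - x)) - K := by
    rw [← Complex.ofReal_one, ← Complex.ofReal_sub, ← Complex.ofReal_log (by linarith)]
    simp
    ring
  rw [e] at h2
  have h3 := abs_add_le ((G x).re + ϑ * Real.log (1 - x) - K) K
  rw [sub_add_cancel] at h3
  have h4 : C * (1 - x) ≤ C * ε := by gcongr
  linarith

-- The contour starts at v = -η with η = 1/n and turns at Re v = δ = c/d. The ray gives the term in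
-- d/n, the arc the exponential term; the constants depend neither on D nor on w.
set_option maxHeartbeats 2000000 in
theorem LogSingular.exists_taylorCoeff_remainder_le {a : ℕ → ℝ} {ϑ K R φ : ℝ} {G : ℂ → ℂ}
    {ε C : ℝ} (h : LogSingular a ϑ K R φ G ε C) (ha : ∀ m, 1 ≤ m → 0 ≤ a m) (hϑ : 0 < ϑ) :
    ∃ c A : ℝ, 0 < c ∧ ∀ n d : ℕ, 1 ≤ n → 1 ≤ d → (d : ℝ) ≤ c * n →
      ∀ D ⊆ Finset.Icc 1 d, ∀ w : ℂ, ‖w‖ = 1 →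
        ‖taylorCoeff (remainder a ϑ K G D w) n‖ *
            (n * Real.exp (-(w.re * (K + ϑ * Real.log n - cycSum a D)))) ≤
          A * (d / n) + Real.exp (A * Real.log n + A - c * (n / d)) := by
  obtain ⟨B, hB0, hB⟩ := h.exists_partial_sum_le ha hϑ
  obtain ⟨δ₁, M, hδ₁, hfar⟩ := h.exists_far_bound hϑ
  have h0 := h.pos
  have h1 := h.lt_half_pi
  have hε := h.ε_pos
  have hC := h.C_pos
  have hπ := Real.pi_pos
  obtain ⟨κ, hκ0, hκ1, hκ⟩ := norm_exp_sub_one_bounds h0 h1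
  have hcos : 0 < Real.cos φ := Real.cos_pos_of_mem_Ioo ⟨by linarith, h1⟩
  have htan : 0 < Real.tan φ := Real.tan_pos_of_pos_of_lt_pi_div_two h0 h1
  have hlR : 0 < Real.log R := Real.log_pos h.one_lt
  obtain ⟨A₂, hA₂⟩ := exists_mul_log_one_add_le (p := ϑ + 1) (μ := Real.cos φ / 2) (by linarith)
    (by positivity)
  -- Chosen so that s + η ≤ δ q along the whole ray, since η ≤ δ.
  set q := 2 / Real.cos φ + 1 with hq
  have hq0 : 0 < q := by positivity
  -- c ≤ 1 keeps |t|^m ≤ e for m ≤ d; c ≤ δ₁ is for the far bound; the next two conditions keep the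
  -- contour in the region; the last two make e^v - 1 comparable to s + η and smaller than ε on the
  -- ray.
  obtain ⟨c, hc0, hc1, hcδ, hcR, hctan, hcq, hcε⟩ : ∃ c : ℝ, 0 < c ∧ c ≤ 1 ∧ c ≤ δ₁ ∧
      c < Real.log R ∧ 2 * c * Real.tan φ < Real.pi ∧ c * q ≤ 1 / 2 ∧ 2 * (c * q) < ε := by
    have ev : ∀ᶠ c : ℝ in 𝓝[>] 0, c ≤ 1 ∧ c ≤ δ₁ ∧
        c < Real.log R ∧ 2 * c * Real.tan φ < Real.pi ∧ c * q ≤ 1 / 2 ∧ 2 * (c * q) < ε := by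
      refine eventually_nhdsWithin_of_eventually_nhds ?_
      have t1 : ContinuousAt (fun c : ℝ => c) 0 := by fun_prop
      have t2 : ContinuousAt (fun c : ℝ => 2 * c * Real.tan φ) 0 := by fun_prop
      have t3 : ContinuousAt (fun c : ℝ => c * q) 0 := by fun_prop
      have t4 : ContinuousAt (fun c : ℝ => 2 * (c * q)) 0 := by fun_prop
      filter_upwards [t1.eventually (eventually_lt_nhds (b := (1 : ℝ)) (by norm_num)),
        t1.eventually (eventually_lt_nhds hδ₁), t1.eventually (eventually_lt_nhds hlR),
        t2.eventually (eventually_lt_nhds (b := Real.pi) (by simpa using hπ)),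
        t3.eventually (eventually_lt_nhds (b := (1 / 2 : ℝ)) (by norm_num)),
        t4.eventually (eventually_lt_nhds (b := ε) (by simpa using hε))] with c a1 a2 a3 a4 a5 a6
      exact ⟨a1.le, a2.le, a3, a4, a5.le, a6⟩
    obtain ⟨c, hc, hc'⟩ := (ev.and self_mem_nhdsWithin).exists
    exact ⟨c, hc', hc⟩
  set E := Real.exp 1 with hE
  set X₁ := 2 * (C + E * B) with hX₁
  have hX₁0 : 0 < X₁ := by positivity
  set Λ := Real.log 2 - Real.log κ with hΛ
  have hlκ : Real.log κ ≤ 0 := Real.log_nonpos hκ0.le hκ1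
  have hl2 : 0 < Real.log 2 := Real.log_pos (by norm_num)
  set A₃ := Real.exp (ϑ * Λ) * Real.exp (ϑ * Real.pi) * (X₁ * Real.exp (X₁ * (c * q))) *
    Real.exp A₂ with hA₃
  have hA₃0 : 0 < A₃ := by positivity
  set A₄ := A₃ * E * (2 / Real.cos φ) with hA₄
  set A₅ := ϑ * (-Real.log c) + (1 + ϑ) * |M| + |K| + E * B with hA₅
  set A₆ := A₅ + Real.log (2 * Real.pi) + |K| + B with hA₆
  set A₇ := ϑ + E * ϑ + 1 + 2 * ϑ with hA₇
  set A := max A₄ (max A₆ A₇)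
  have a4 : A₄ ≤ A := by simp [A]
  have a6 : A₆ ≤ A := by simp [A]
  have a7 : A₇ ≤ A := by simp [A]
  clear_value A A₇ A₆ A₅ A₄ A₃ Λ X₁ q
  refine ⟨c, A, hc0, fun n d hn hd hdn D hD w hw => ?_⟩
  have hn0 : (1 : ℝ) ≤ n := by exact_mod_cast hn
  have hd0 : (1 : ℝ) ≤ d := by exact_mod_cast hd
  have hdn' : (d : ℝ) ≤ n := hdn.trans (mul_le_of_le_one_left (by linarith) hc1)
  have hlogdn : Real.log d ≤ Real.log n := Real.log_le_log (by linarith) hdn'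
  obtain ⟨hB1, hB2⟩ := hB d hd
  set S := cycSum a D with hS
  have hS0 : 0 ≤ S := cycSum_nonneg ha hD
  have hSB : S ≤ ϑ * Real.log d + B := (cycSum_le ha hD).trans hB2
  set lam := K + ϑ * Real.log n - S with hlam
  set δ := c / d with hδ
  have hδ0 : 0 < δ := by positivity
  have hδc : δ ≤ c := div_le_self hc0.le hd0
  set η : ℝ := 1 / n with hη
  have hη0 : 0 < η := by positivity
  have hηδ : η ≤ δ := by
    rw [hη, hδ, div_le_div_iff₀ (by linarith) (by linarith)]
    linarith
  have hδd : δ * d = c := by rw [hδ]; field_simp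
  set l := (δ + η) / Real.cos φ with hl
  have hlq : l + η ≤ δ * q := by
    have : l ≤ 2 * δ / Real.cos φ := by
      rw [hl]; gcongr; linarith
    have e : δ * q = 2 * δ / Real.cos φ + δ := by rw [hq]; ring
    linarith
  have hre : |w.re| ≤ 1 := (Complex.abs_re_le_norm w).trans hw.le
  have hpow : ∀ t : ℂ, ‖t‖ ≤ Real.exp δ → ∀ m ≤ d, ‖t‖ ^ m ≤ Real.exp 1 := by
    intro t ht m hm
    calc ‖t‖ ^ m ≤ Real.exp δ ^ m := pow_le_pow_left₀ (norm_nonneg _) ht m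
      _ ≤ Real.exp δ ^ d := pow_le_pow_right₀ (Real.one_le_exp hδ0.le) hm
      _ ≤ Real.exp 1 := by
        rw [← Real.exp_nat_mul]
        exact Real.exp_le_exp.2 (by rw [mul_comm, hδd]; exact hc1)
  set P := Real.exp (w.re * lam) * A₃ * (d / n) with hP
  have hP0 : 0 ≤ P := by positivity
  clear_value P l η δ lam
  have hnear : ∀ s ∈ Set.Icc 0 l, ∀ t ∈ Delta 1 R φ, κ * (s + η) ≤ ‖t - 1‖ →
      ‖t - 1‖ ≤ 2 * (s + η) → ‖t‖ ≤ Real.exp δ →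
      ‖remainder a ϑ K G D w t‖ ≤ P * Real.exp (Real.cos φ / 2 * (n * s)) := by
    intro s hs t htΔ ht1 ht2 ht3
    obtain ⟨hs0, hsl⟩ := hs
    set τ := s + η with hτ
    have hτ0 : 0 < τ := by positivity
    have hτq : τ ≤ δ * q := by linarith
    have hdτ : d * τ ≤ c * q := by
      calc (d : ℝ) * τ ≤ d * (δ * q) := by gcongr
        _ = c * q := by rw [← hδd]; ring
    have hτc : τ ≤ c * q := hτq.trans (by gcongr)
    have hX : (C + E * ∑ m ∈ Finset.Icc 1 d, a m) * ‖t - 1‖ ≤ X₁ * (d * τ) := by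
      have e1 : C + E * ∑ m ∈ Finset.Icc 1 d, a m ≤ (C + E * B) * d := by
        have i1 : E * ∑ m ∈ Finset.Icc 1 d, a m ≤ E * (B * d) := by gcongr
        have i2 : C ≤ C * d := le_mul_of_one_le_right hC.le hd0
        linarith
      calc _ ≤ ((C + E * B) * d) * (2 * τ) :=
            mul_le_mul e1 ht2 (norm_nonneg _) (by positivity)
        _ = _ := by rw [hX₁]; ring
    have key := h.norm_remainder_near_le ha hϑ hD htΔ (by linarith) (hpow t ht3) hw hX
    have hτn : τ = (1 + n * s) / n := by rw [hτ, hη]; field_simp; ring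
    -- Since s + η = (1 + ns)/n, the powers of s + η split into powers of n and of e^U.
    set U := Real.log (1 + n * s) with hU
    have hU0 : 0 ≤ U := Real.log_nonneg (le_add_of_nonneg_right (by positivity))
    have hτU : τ = Real.exp U / n := by rw [hU, Real.exp_log (by positivity), hτn]
    have hlogτ : Real.log τ = U - Real.log n := by
      rw [hτn, Real.log_div (by positivity) (by positivity)]
    -- Re w may have either sign, so |t - 1| must be controlled from both sides.
    have hL : -(ϑ * (w.re * Real.log ‖1 - t‖)) ≤ ϑ * Λ + w.re * (ϑ * Real.log n) + ϑ * U := by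
      rw [norm_sub_rev]
      have b1 := Real.log_le_log (by positivity) ht1
      have b2 := Real.log_le_log (lt_of_lt_of_le (by positivity) ht1) ht2
      rw [Real.log_mul hκ0.ne' hτ0.ne'] at b1
      rw [Real.log_mul (by norm_num) hτ0.ne'] at b2
      have b3 : |Real.log ‖t - 1‖ - Real.log τ| ≤ Λ := abs_le.2 ⟨by linarith, by linarith⟩
      have b4 : |w.re * (Real.log ‖t - 1‖ - Real.log τ)| ≤ Λ := by
        rw [abs_mul]
        calc _ ≤ 1 * Λ := mul_le_mul hre b3 (abs_nonneg _) zero_le_one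
          _ = Λ := one_mul _
      have b5 : |w.re * U| ≤ U := by
        rw [abs_mul, abs_of_nonneg hU0]
        exact mul_le_of_le_one_left hU0 hre
      have b6 := (abs_le.1 b4).1
      have b7 := (abs_le.1 b5).1
      rw [hlogτ] at b6
      have b8 : -(w.re * Real.log ‖t - 1‖) ≤ Λ + w.re * Real.log n + U := by linarith
      have := mul_le_mul_of_nonneg_left b8 hϑ.le
      linarith
    have hXe : X₁ * (d * τ) * Real.exp (X₁ * (d * τ)) ≤
        X₁ * (d * τ) * Real.exp (X₁ * (c * q)) := by gcongr
    calc _ ≤ Real.exp (w.re * (K - S)) * (Real.exp (ϑ * Λ + w.re * (ϑ * Real.log n) + ϑ * U) *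
          Real.exp (ϑ * Real.pi)) * (X₁ * (d * τ) * Real.exp (X₁ * (c * q))) := by
          refine key.trans ?_
          gcongr
      _ = Real.exp (w.re * lam) * (Real.exp (ϑ * Λ) * Real.exp (ϑ * Real.pi) *
          (X₁ * Real.exp (X₁ * (c * q)))) * (d / n) * Real.exp ((ϑ + 1) * U) := by
          -- The factor n^{ϑ Re w} completes e^{Re w (K - S)} to e^{Re w λ}; the further factor dτ
          -- supplies d/n and one more e^U.
          have e1 : Real.exp (w.re * lam) =
              Real.exp (w.re * (K - S)) * Real.exp (w.re * (ϑ * Real.log n)) := by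
            rw [← Real.exp_add, hlam]; ring_nf
          have e2 : Real.exp ((ϑ + 1) * U) = Real.exp (ϑ * U) * Real.exp U := by
            rw [← Real.exp_add]; ring_nf
          rw [e1, e2, Real.exp_add, Real.exp_add, hτU]
          ring
      _ ≤ Real.exp (w.re * lam) * (Real.exp (ϑ * Λ) * Real.exp (ϑ * Real.pi) *
          (X₁ * Real.exp (X₁ * (c * q)))) * (d / n) *
            Real.exp (Real.cos φ / 2 * (n * s) + A₂) := by
          gcongr
          exact hA₂ (n * s) (by positivity)
      _ = _ := by rw [Real.exp_add, hP, hA₃]; ring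
  have hfar' : ∀ t ∈ Delta 1 R φ, ‖t‖ = Real.exp δ →
      ‖remainder a ϑ K G D w t‖ ≤ 2 * Real.exp ((ϑ + E * ϑ) * Real.log n + A₅) := by
    intro t htΔ htn
    obtain ⟨f1, f2⟩ := hfar δ hδ0 (hδc.trans hcδ) t htΔ htn
    have key := LogSingular.norm_remainder_far_le (K := K) ha hϑ hD (hpow t htn.le) hw f1 f2
    refine key.trans (mul_le_mul_of_nonneg_left (Real.exp_le_exp.2 ?_) (by norm_num))
    rw [← hE, ← hS]
    have e1 : -Real.log δ = Real.log d - Real.log c := by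
      rw [hδ, Real.log_div (by positivity) (by positivity)]; ring
    rw [e1]
    have e2 : E * S ≤ E * (ϑ * Real.log n + B) := by
      have : ϑ * Real.log d ≤ ϑ * Real.log n := by gcongr
      gcongr
      linarith
    have e3 : ϑ * (Real.log d - Real.log c) ≤ ϑ * (Real.log n - Real.log c) := by gcongr
    rw [hA₅]
    linarith
  have hmain : ‖taylorCoeff (remainder a ϑ K G D w) n‖ ≤
      P * E * (2 / (n * Real.cos φ)) +
        2 * Real.exp ((ϑ + E * ϑ) * Real.log n + A₅) * Real.exp (-n * δ) * Real.pi := by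
    have hb : ContinuousOn (fun s => P * Real.exp (Real.cos φ / 2 * (n * s)))
        (Set.Icc 0 ((δ - -η) / Real.cos φ)) := by fun_prop
    have hsin : 0 < Real.sin φ := Real.sin_pos_of_pos_of_lt_pi h0 (by linarith)
    have htc : Real.tan φ * Real.cos φ = Real.sin φ := Real.tan_mul_cos hcos.ne'
    have hδη : (δ + η) * Real.tan φ < Real.pi := by
      refine lt_of_le_of_lt ?_ hctan
      gcongr
      linarith
    have hconj : ∀ t : ℂ, ‖(starRingEnd ℂ) t - 1‖ = ‖t - 1‖ := fun t => by
      rw [← Complex.norm_conj (t - 1), map_sub, map_one]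
    have hnorm := norm_taylorCoeff_le h.one_lt h0 h1 (h.differentiableOn_remainder D w) n
      (a := -η) (δ := δ) (b := fun s => P * Real.exp (Real.cos φ / 2 * (n * s)))
      (M := 2 * Real.exp ((ϑ + E * ϑ) * Real.log n + A₅))
      (by linarith) hδ0 (by linarith) (by rw [sub_neg_eq_add]; exact hδη) hb ?_ ?_
    · refine hnorm.trans (add_le_add ?_ le_rfl)
      -- As nη = 1, the starting point costs only a factor e, and half of the decay e^{-ns cos φ}
      -- survives.
      have e1 : ∀ s : ℝ, P * Real.exp (Real.cos φ / 2 * (n * s)) *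
          Real.exp (-n * (-η + s * Real.cos φ)) =
          P * E * Real.exp (-((n * Real.cos φ / 2) * s)) := by
        intro s
        rw [mul_assoc, mul_assoc, ← Real.exp_add, hE, ← Real.exp_add]
        congr 2
        have : (n : ℝ) * η = 1 := by rw [hη]; field_simp
        linear_combination this
      simp only [e1]
      rw [intervalIntegral.integral_const_mul]
      refine mul_le_mul_of_nonneg_left ?_ (by positivity)
      refine (integral_exp_neg_mul_le (by positivity)).trans (le_of_eq ?_)
      field_simp
    · intro s hs
      rw [sub_neg_eq_add, ← hl] at hs
      set v : ℂ := ((-η : ℝ) : ℂ) + s * Complex.exp (φ * Complex.I) with hv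
      have vre : v.re = -η + s * Real.cos φ := by
        rw [hv, Complex.exp_mul_I, ← Complex.ofReal_cos, ← Complex.ofReal_sin]
        simp [-Complex.ofReal_cos, -Complex.ofReal_sin]
      have vim : v.im = s * Real.sin φ := by
        rw [hv, Complex.exp_mul_I, ← Complex.ofReal_cos, ← Complex.ofReal_sin]
        simp [-Complex.ofReal_cos, -Complex.ofReal_sin]
      have hsl : s * Real.cos φ ≤ δ + η := (le_div_iff₀ hcos).1 (hl ▸ hs.2)
      have hvre : v.re ≤ δ := by rw [vre]; linarith
      have hvU : v ∈ upperRegion R φ := by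
        refine ⟨by linarith, ?_, ?_⟩
        · rw [vre, vim]
          linarith [mul_pos hη0 hsin]
        · rw [vim, ← htc]
          have := mul_le_mul_of_nonneg_right hsl htan.le
          linarith
      have hΔ := exp_mem_Delta_of_mem_upperRegion h.one_lt h0 h1 hvU
      have hvn : ‖Complex.exp v‖ ≤ Real.exp δ := by
        rw [Complex.norm_exp]; exact Real.exp_le_exp.2 hvre
      have hτ2 : s + η ≤ 1 / 2 := by
        have : δ * q ≤ c * q := by gcongr
        linarith [hs.2]
      obtain ⟨k1, k2⟩ := hκ η s hη0 hs.1 hτ2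
      refine ⟨hnear s hs _ hΔ k1 k2 hvn, hnear s hs _ (conj_mem_Delta hΔ) ?_ ?_ ?_⟩
      · rw [hconj]; exact k1
      · rw [hconj]; exact k2
      · rw [Complex.norm_conj]; exact hvn
    · intro y hy
      rw [sub_neg_eq_add] at hy
      have hvU : (δ : ℂ) + y * Complex.I ∈ upperRegion R φ := by
        refine ⟨by simp; linarith, ?_, by simp; linarith [hy.2]⟩
        simp
        have := mul_le_mul_of_nonneg_right hy.1 hcos.le
        rw [mul_assoc, htc] at this
        linarith [mul_pos hη0 hsin]
      have hΔ := exp_mem_Delta_of_mem_upperRegion h.one_lt h0 h1 hvU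
      have hvn : ‖Complex.exp ((δ : ℂ) + y * Complex.I)‖ = Real.exp δ := by
        rw [Complex.norm_exp]; simp
      exact ⟨hfar' _ hΔ hvn, hfar' _ (conj_mem_Delta hΔ) (by rw [Complex.norm_conj]; exact hvn)⟩
  set ω := (n : ℝ) * Real.exp (-(w.re * lam)) with hω
  have hω0 : 0 ≤ ω := by positivity
  refine (mul_le_mul_of_nonneg_right hmain hω0).trans ?_
  rw [add_mul]
  have hexp : Real.exp (w.re * lam) * Real.exp (-(w.re * lam)) = 1 := by
    rw [← Real.exp_add]; simp
  refine add_le_add ?_ ?_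
  · calc P * E * (2 / (n * Real.cos φ)) * ω =
        A₄ * (d / n) * (Real.exp (w.re * lam) * Real.exp (-(w.re * lam))) := by
          rw [hP, hω, hA₄]; field_simp
      _ = A₄ * (d / n) := by rw [hexp, mul_one]
      _ ≤ A * (d / n) := by gcongr
  -- On the arc, undoing the normalisation costs n e^{|λ|}, which is again at most a power of n.
  · have hlam' : -(w.re * lam) ≤ |K| + 2 * ϑ * Real.log n + B := by
      have b1 : |lam| ≤ |K| + 2 * ϑ * Real.log n + B := by
        have : ϑ * Real.log d ≤ ϑ * Real.log n := by gcongr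
        have : 0 ≤ ϑ * Real.log n := by positivity
        rw [abs_le, hlam]
        constructor <;> linarith [le_abs_self K, neg_abs_le K]
      have b2 : |w.re * lam| ≤ |lam| := by
        rw [abs_mul]; exact mul_le_of_le_one_left (abs_nonneg _) hre
      linarith [neg_abs_le (w.re * lam)]
    have en : (n : ℝ) = Real.exp (Real.log n) := (Real.exp_log (by linarith)).symm
    have e2π : 2 * Real.pi = Real.exp (Real.log (2 * Real.pi)) :=
      (Real.exp_log (by positivity)).symm
    calc _ = Real.exp ((ϑ + E * ϑ) * Real.log n + A₅) * Real.exp (-n * δ) *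
          (2 * Real.pi) * (n * Real.exp (-(w.re * lam))) := by rw [hω]; ring
      _ = Real.exp ((ϑ + E * ϑ) * Real.log n + A₅ + -n * δ + Real.log (2 * Real.pi) +
          (Real.log n + -(w.re * lam))) := by
          rw [Real.exp_add _ (Real.log n + _), Real.exp_add (Real.log n), ← en,
            Real.exp_add _ (Real.log (2 * Real.pi)), ← e2π, Real.exp_add _ (-n * δ)]
      _ ≤ _ := by
          refine Real.exp_le_exp.2 ?_
          have e1 : (n : ℝ) * δ = c * (n / d) := by rw [hδ]; ring
          have e2 : A₇ * Real.log n ≤ A * Real.log n := by gcongr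
          rw [hA₇] at e2
          rw [hA₆] at a6
          linarith

/-! ### The weighted measure and the generating function of the cycle count. -/

theorem cycleIndex_mul_pow (c : ℕ → ℂ) (x : ℂ) (n : ℕ) :
    cycleIndex (fun m => c m * x ^ m) n = x ^ n * cycleIndex c n := by
  rw [cycleIndex, cycleIndex, Finset.mul_sum]
  refine Finset.sum_congr rfl fun p _ => ?_
  have h1 : (p.parts.map fun m => x ^ m).prod = x ^ n := by
    have h : ∀ s : Multiset ℕ, (s.map fun m => x ^ m).prod = x ^ s.sum := by
      intro s
      induction s using Multiset.induction with
      | empty => simp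
      | cons a s ih => simp [ih, pow_add]
    rw [h, p.parts_sum]
  rw [partWeight, partWeight, Multiset.prod_map_mul, h1]
  ring

theorem cycleIndex_congr {c c' : ℕ → ℂ} {n : ℕ} (h : ∀ m ∈ Finset.Icc 1 n, c m = c' m) :
    cycleIndex c n = cycleIndex c' n := by
  refine Finset.sum_congr rfl fun p _ => ?_
  rw [partWeight, partWeight, Multiset.map_congr rfl fun m hm => h m (Finset.mem_Icc.2
    ⟨p.parts_pos hm, p.le_of_mem_parts hm⟩)]

/-- The normalised generating function `(1 / n!) ∑_σ weight(σ) w ^ T(σ)`. -/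
noncomputable def cycleGen (θ : ℕ → ℝ) (n : ℕ) (A : Finset ℕ) (w : ℂ) : ℂ :=
  cycleIndex (fun m => w * ((if m ∈ A then θ m else 0 : ℝ) : ℂ)) n

theorem totalCycles_eq_card {n : ℕ} (σ : Equiv.Perm (Fin n)) :
    totalCycles σ = Multiset.card (cycleLengths σ) := by
  refine Multiset.sum_count_eq_card fun m hm => Finset.mem_Icc.2 ⟨σ.partition.parts_pos hm, ?_⟩
  simpa using σ.partition.le_of_mem_parts hm

theorem cycleGen_eq_sum (θ : ℕ → ℝ) (n : ℕ) (A : Finset ℕ) (w : ℂ) :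
    cycleGen θ n A w =
      (1 / (n.factorial : ℂ)) * ∑ σ : Equiv.Perm (Fin n), (weight θ A σ : ℂ) * w ^ totalCycles σ := by
  rw [cycleGen, ← sum_perm_eq_cycleIndex]
  congr 1
  refine Finset.sum_congr rfl fun σ _ => ?_
  rw [Multiset.prod_map_mul, Multiset.map_const', Multiset.prod_replicate, totalCycles_eq_card,
    mul_comm, weight]
  congr 1
  rw [← Complex.ofRealHom_eq_coe, map_multiset_prod, Multiset.map_map]
  rfl

theorem cycleGen_one (θ : ℕ → ℝ) (n : ℕ) (A : Finset ℕ) : cycleGen θ n A 1 = (h θ n A : ℂ) := by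
  rw [cycleGen_eq_sum, h]
  push_cast
  simp

theorem weight_nonneg {θ : ℕ → ℝ} (hθ : ∀ m : ℕ, 1 ≤ m → 0 ≤ θ m) (A : Finset ℕ) {n : ℕ}
    (σ : Equiv.Perm (Fin n)) : 0 ≤ weight θ A σ := by
  refine Multiset.prod_nonneg fun x hx => ?_
  obtain ⟨m, hm, rfl⟩ := Multiset.mem_map.1 hx
  split_ifs
  · exact hθ m (σ.partition.parts_pos hm)
  · exact le_rfl

theorem h_nonneg {θ : ℕ → ℝ} (hθ : ∀ m : ℕ, 1 ≤ m → 0 ≤ θ m) (n : ℕ) (A : Finset ℕ) :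
    0 ≤ h θ n A :=
  mul_nonneg (by positivity) (Finset.sum_nonneg fun σ _ => weight_nonneg hθ A σ)

theorem isProbabilityMeasure_weightedMeasure {θ : ℕ → ℝ} (hθ : ∀ m : ℕ, 1 ≤ m → 0 ≤ θ m)
    {n : ℕ} {A : Finset ℕ} (hpos : 0 < h θ n A) :
    IsProbabilityMeasure (weightedMeasure θ n A) := by
  constructor
  rw [weightedMeasure, Measure.finsetSum_apply]
  simp only [Measure.smul_apply, measure_univ, smul_eq_mul, mul_one]
  rw [← ENNReal.ofReal_sum_of_nonneg fun σ _ => mul_nonneg (by positivity) (weight_nonneg hθ A σ),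
    ← Finset.mul_sum, ENNReal.ofReal_eq_one]
  have h1 : ∑ σ : Equiv.Perm (Fin n), weight θ A σ = h θ n A * n.factorial := by
    rw [h]; field_simp
  rw [h1]
  field_simp

theorem integral_weightedMeasure {θ : ℕ → ℝ} (hθ : ∀ m : ℕ, 1 ≤ m → 0 ≤ θ m)
    {n : ℕ} {A : Finset ℕ} (hpos : 0 < h θ n A) (s : ℝ) :
    ∫ σ, Complex.exp (Complex.I * s * ((totalCycles σ : ℝ) : ℂ)) ∂(weightedMeasure θ n A) =
      cycleGen θ n A (Complex.exp (Complex.I * s)) / h θ n A := by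
  have hn' : (n.factorial : ℂ) ≠ 0 := by exact_mod_cast n.factorial_ne_zero
  have hh : (h θ n A : ℂ) ≠ 0 := by exact_mod_cast hpos.ne'
  rw [weightedMeasure, integral_finsetSum_measure, cycleGen_eq_sum, Finset.mul_sum, Finset.sum_div]
  · refine Finset.sum_congr rfl fun σ _ => ?_
    rw [integral_smul_measure, integral_dirac, ENNReal.toReal_ofReal
      (mul_nonneg (by positivity) (weight_nonneg hθ A σ)), Complex.real_smul, ← Complex.exp_nat_mul]
    push_cast
    rw [mul_comm (totalCycles σ : ℂ)]
    field_simp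
  · intro σ _
    exact (integrable_dirac (by simp)).smul_measure ENNReal.ofReal_ne_top

theorem one_le_maxOrOne {n : ℕ} (A : Finset ℕ) : 1 ≤ maxOrOne (forbidden n A) := by
  rw [maxOrOne]
  split_ifs with h
  · have := Finset.max'_mem _ h
    exact (Finset.mem_Icc.1 (Finset.mem_sdiff.1 this).1).1
  · exact le_rfl

theorem forbidden_subset_Icc {n : ℕ} (A : Finset ℕ) :
    forbidden n A ⊆ Finset.Icc 1 (maxOrOne (forbidden n A)) := by
  intro m hm
  have h : (forbidden n A).Nonempty := ⟨m, hm⟩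
  rw [maxOrOne, dif_pos h]
  exact Finset.mem_Icc.2 ⟨(Finset.mem_Icc.1 (Finset.mem_sdiff.1 hm).1).1, Finset.le_max' _ m hm⟩

theorem L_eq_cycSum (θ : ℕ → ℝ) (D : Finset ℕ) (r : ℝ) :
    L θ D r = cycSum (fun m => θ m * r ^ m) D :=
  Finset.sum_congr rfl fun m _ => by ring

theorem taylorCoeff_zero (F : ℂ → ℂ) : taylorCoeff F 0 = F 0 := by simp [taylorCoeff]

theorem taylorCoeff_sub_const_mul {F H : ℂ → ℂ} (hF : AnalyticAt ℂ F 0) (hH : AnalyticAt ℂ H 0)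
    (c : ℂ) (n : ℕ) :
    taylorCoeff (fun z => F z - c * H z) n = taylorCoeff F n - c * taylorCoeff H n := by
  have hcH : AnalyticAt ℂ (fun z => c * H z) 0 := analyticAt_const.mul hH
  rw [taylorCoeff, iteratedDeriv_fun_sub hF.contDiffAt hcH.contDiffAt,
    iteratedDeriv_const_mul_field, taylorCoeff, taylorCoeff]
  ring

section LogSingular

variable {θ : ℕ → ℝ} {r ϑ K R φ : ℝ} {G : ℂ → ℂ} {ε C : ℝ}

theorem LogSingular.hasSum_sub_cycPoly {a : ℕ → ℝ} (hL : LogSingular a ϑ K R φ G ε C)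
    (D : Finset ℕ) (w : ℂ) {t : ℂ} (ht : ‖t‖ < 1) :
    HasSum (fun m : ℕ => w * ((if m ∈ D then 0 else a m / m : ℝ) : ℂ) * t ^ m)
      (w * (G t - cycPoly a D t)) := by
  have h1 := hL.hasSum t ht
  have h2 : HasSum (fun m : ℕ => if m ∈ D then ((a m / m : ℝ) : ℂ) * t ^ m else 0)
      (cycPoly a D t) := by
    have h3 : HasSum (fun m : ℕ => if m ∈ D then ((a m / m : ℝ) : ℂ) * t ^ m else 0)
        (∑ m ∈ D, if m ∈ D then ((a m / m : ℝ) : ℂ) * t ^ m else 0) :=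
      hasSum_sum_of_ne_finset_zero fun m hm => if_neg hm
    rwa [Finset.sum_congr rfl fun m hm => if_pos hm] at h3
  refine hasSum_of_forall_eq ((h1.sub h2).mul_left w) fun m => ?_
  split_ifs
  · simp
  · simp only [sub_zero]; ring

/-- For m in {1, …, n}, m ∉ D means m ∈ A, so the exponential formula applies to the coefficients up
to n; homogeneity of the cycle index turns the factors r^m into r^n. -/
theorem LogSingular.taylorCoeff_remainder
    (hL : LogSingular (fun m => θ m * r ^ m) ϑ K R φ G ε C) (n : ℕ) (A : Finset ℕ) (w : ℂ) :
    taylorCoeff (remainder (fun m => θ m * r ^ m) ϑ K G (forbidden n A) w) n =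
      r ^ n * cycleGen θ n A w -
        Complex.exp (w * (K - cycSum (fun m => θ m * r ^ m) (forbidden n A))) *
          negBinom (w * ϑ) n := by
  set a : ℕ → ℝ := fun m => θ m * r ^ m with ha
  set D := forbidden n A with hD
  set P : ℂ → ℂ := fun t => w * (G t - cycPoly a D t)
  have hs : ∀ᶠ t in 𝓝 (0 : ℂ),
      HasSum (fun m : ℕ => w * ((if m ∈ D then 0 else a m / m : ℝ) : ℂ) * t ^ m) (P t) := by
    filter_upwards [Metric.ball_mem_nhds (0 : ℂ) one_pos] with t ht
    exact hL.hasSum_sub_cycPoly D w (by simpa using ht)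
  have hPc := taylorCoeff_eq_of_hasSum hs
  have hPa : AnalyticAt ℂ P 0 := (hPc 0).1
  have hP0 : P 0 = 0 := by
    rw [← taylorCoeff_zero P, (hPc 0).2]
    simp
  have h1 : taylorCoeff (fun z => Complex.exp (P z)) n = r ^ n * cycleGen θ n A w := by
    rw [taylorCoeff_exp_eq_cycleIndex hPa hP0 (fun m => m * taylorCoeff P m) n fun m _ => rfl,
      cycleGen, ← cycleIndex_mul_pow]
    refine cycleIndex_congr fun m hm => ?_
    have hm0 : (m : ℂ) ≠ 0 := by
      have := (Finset.mem_Icc.1 hm).1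
      exact_mod_cast (by omega : m ≠ 0)
    have hmD : m ∈ D ↔ m ∉ A := by
      rw [hD, forbidden, Finset.mem_sdiff]
      exact and_iff_right hm
    rw [(hPc m).2]
    by_cases hmA : m ∈ A
    · rw [if_neg (by rw [hmD]; exact not_not.2 hmA), if_pos hmA, ha]
      push_cast
      field_simp
    · rw [if_pos (hmD.2 hmA), if_neg hmA]
      simp
  have h2 := taylorCoeff_exp_neg_mul_log (w * ϑ) n
  have h3 : AnalyticAt ℂ (fun z => Complex.exp (-(w * ϑ) * Complex.log (1 - z))) 0 :=
    (taylorCoeff_eq_of_hasSum (eventually_hasSum_neg_mul_log (w * ϑ)) 0).1.cexp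
  have h4 : AnalyticAt ℂ (fun z => Complex.exp (P z)) 0 := hPa.cexp
  rw [← h1, ← h2, ← taylorCoeff_sub_const_mul h4 h3]
  rfl

end LogSingular

/-! ### Limit of the normalised generating function and growth of the parameters. -/

/-- The normalised generating function at `w = e ^ {is}`. -/
noncomputable def normGen (θ : ℕ → ℝ) (r : ℝ) (lam : ℝ) (n : ℕ) (A : Finset ℕ) (s : ℝ) : ℂ :=
  (r : ℂ) ^ n * cycleGen θ n A (Complex.exp (Complex.I * s)) * n *
    Complex.exp (-(Complex.exp (Complex.I * s) * lam))

theorem continuous_one_div_Gamma (ϑ : ℝ) :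
    Continuous fun s : ℝ => 1 / Complex.Gamma (ϑ * Complex.exp (Complex.I * s)) := by
  have h := Complex.differentiable_one_div_Gamma.continuous
  simp only [one_div]
  exact h.comp (by fun_prop)

section

variable {θ : ℕ → ℝ} {r ϑ K : ℝ} {A : ℕ → Finset ℕ}

theorem tendsto_div_maxOrOne (hd : ∀ C : ℝ, Tendsto
      (fun n : ℕ => C * Real.log n - (n : ℝ) / (maxOrOne (forbidden n (A n)) : ℝ)) atTop atBot) :
    Tendsto (fun n : ℕ => (n : ℝ) / (maxOrOne (forbidden n (A n)) : ℝ)) atTop atTop := by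
  have := tendsto_neg_atBot_atTop.comp (hd 0)
  refine this.congr fun n => ?_
  simp

/-- Its distance to `normNegBinom` at wϑ is exactly the normalised coefficient of the remainder,
bounded uniformly on |w| = 1; all points wϑ lie in the closed ball of radius ϑ. -/
theorem tendstoUniformly_normGen (hθ : ∀ m : ℕ, 1 ≤ m → 0 ≤ θ m) (hr : 0 < r) (hϑ : 0 < ϑ)
    (hg : GenFunInClassF θ r ϑ K)
    (hd : ∀ C : ℝ, Tendsto
      (fun n : ℕ => C * Real.log n - (n : ℝ) / (maxOrOne (forbidden n (A n)) : ℝ)) atTop atBot) :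
    TendstoUniformly
      (fun (n : ℕ) (s : ℝ) => normGen θ r (K + ϑ * Real.log n - L θ (forbidden n (A n)) r) n (A n) s)
      (fun s : ℝ => 1 / Complex.Gamma (ϑ * Complex.exp (Complex.I * s))) atTop := by
  obtain ⟨R, φ, G, ε, C, hL⟩ := hg.exists_logSingular hr
  have ha : ∀ m : ℕ, 1 ≤ m → 0 ≤ θ m * r ^ m := fun m hm => mul_nonneg (hθ m hm) (by positivity)
  obtain ⟨c, B, hc, hB⟩ := hL.exists_taylorCoeff_remainder_le ha hϑ
  set d : ℕ → ℕ := fun n => maxOrOne (forbidden n (A n)) with hdd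
  have hq := tendsto_div_maxOrOne hd
  have hlim : Tendsto (fun n : ℕ => B * ((d n : ℝ) / n) +
      Real.exp (B * Real.log n + B - c * ((n : ℝ) / d n))) atTop (𝓝 0) := by
    have t1 : Tendsto (fun n : ℕ => (d n : ℝ) / n) atTop (𝓝 0) := by
      refine (tendsto_inv_atTop_zero.comp hq).congr fun n => ?_
      simp [hdd]
    -- The hypothesis on d_n is used with C = B/c and multiplied by c.
    have t2 : Tendsto (fun n : ℕ => B * Real.log n + B - c * ((n : ℝ) / d n)) atTop atBot := by
      have := ((hd (B / c)).const_mul_atBot hc)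
      refine (tendsto_atBot_add_const_right _ B this).congr fun n => ?_
      simp only [hdd]
      field_simp
      ring
    have := (t1.const_mul B).add (Real.tendsto_exp_atBot.comp t2)
    simpa using this
  rw [Metric.tendstoUniformly_iff]
  intro e he
  have hG := (Metric.tendstoUniformlyOn_iff.1 (tendstoUniformlyOn_normNegBinom ϑ)) (e / 2)
    (by positivity)
  filter_upwards [hG, hlim.eventually (eventually_lt_nhds (half_pos he)), eventually_ge_atTop 1,
    hq.eventually (eventually_ge_atTop (1 / c))] with n h1 h2 hn h3 s
  set w := Complex.exp (Complex.I * s) with hw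
  have hw1 : ‖w‖ = 1 := by rw [hw, mul_comm]; exact Complex.norm_exp_ofReal_mul_I s
  have hd1 : 1 ≤ d n := one_le_maxOrOne (A n)
  have hd0 : (0 : ℝ) < d n := by exact_mod_cast hd1
  have hdn : (d n : ℝ) ≤ c * n := by
    rw [div_le_div_iff₀ hc hd0] at h3
    linarith
  have h4 := hB n (d n) hn hd1 hdn _ (forbidden_subset_Icc (A n)) w hw1
  rw [hL.taylorCoeff_remainder, ← L_eq_cycSum] at h4
  have h5 := h1 (w * ϑ) (by
    rw [mem_closedBall_zero_iff, norm_mul, hw1, Complex.norm_real, Real.norm_of_nonneg hϑ.le,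
      one_mul])
  set lam := K + ϑ * Real.log n - L θ (forbidden n (A n)) r with hlam
  rw [dist_eq_norm] at h5 ⊢
  have e1 : normGen θ r lam n (A n) s - normNegBinom (w * ϑ) n =
      (r ^ n * cycleGen θ n (A n) w -
        Complex.exp (w * (K - L θ (forbidden n (A n)) r)) * negBinom (w * ϑ) n) *
          (n * Complex.exp (-(w * lam))) := by
    have e2 : Complex.exp (w * (K - L θ (forbidden n (A n)) r)) * Complex.exp (-(w * lam)) =
        Complex.exp (-(w * ϑ) * Real.log n) := by
      rw [← Complex.exp_add, hlam]
      congr 1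
      push_cast
      ring
    rw [normGen, normNegBinom, ← hw, ← e2]
    ring
  have e3 : ‖(n : ℂ) * Complex.exp (-(w * lam))‖ = n * Real.exp (-(w.re * lam)) := by
    rw [norm_mul, Complex.norm_natCast, Complex.norm_exp]
    simp
  have h6 : ‖normGen θ r lam n (A n) s - normNegBinom (w * ϑ) n‖ < e / 2 := by
    rw [e1, norm_mul, e3]
    exact h4.trans_lt h2
  rw [mul_comm (ϑ : ℂ) w, ← norm_neg, neg_sub]
  have h7 := norm_sub_le (normGen θ r lam n (A n) s - normNegBinom (w * ϑ) n)
    (1 / Complex.Gamma (w * ϑ) - normNegBinom (w * ϑ) n)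
  rw [sub_sub_sub_cancel_right] at h7
  linarith

/-- Since S ≤ ϑ log d + B, the parameter is at least ϑ log(n/d) + K - B, and n/d → ∞. -/
theorem tendsto_parameter_atTop (hθ : ∀ m : ℕ, 1 ≤ m → 0 ≤ θ m) (hr : 0 < r) (hϑ : 0 < ϑ)
    (hg : GenFunInClassF θ r ϑ K)
    (hd : ∀ C : ℝ, Tendsto
      (fun n : ℕ => C * Real.log n - (n : ℝ) / (maxOrOne (forbidden n (A n)) : ℝ)) atTop atBot) :
    Tendsto (fun n : ℕ => K + ϑ * Real.log n - L θ (forbidden n (A n)) r) atTop atTop := by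
  obtain ⟨R, φ, G, ε, C, hL⟩ := hg.exists_logSingular hr
  have ha : ∀ m : ℕ, 1 ≤ m → 0 ≤ θ m * r ^ m := fun m hm => mul_nonneg (hθ m hm) (by positivity)
  obtain ⟨B, -, hB⟩ := hL.exists_partial_sum_le ha hϑ
  have h1 := tendsto_atTop_add_const_left _ (K - B)
    ((Real.tendsto_log_atTop.comp (tendsto_div_maxOrOne hd)).const_mul_atTop hϑ)
  refine tendsto_atTop_mono' _ ?_ h1
  filter_upwards [eventually_ge_atTop 1] with n hn
  have hd1 := one_le_maxOrOne (n := n) (A n)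
  have h2 := (cycSum_le ha (forbidden_subset_Icc (A n))).trans (hB _ hd1).2
  rw [← L_eq_cycSum] at h2
  rw [Function.comp_apply, Real.log_div (by positivity) (by positivity)]
  linarith

end

end WeightedPerm

/-! ### Conclusion. -/

open WeightedPerm in
theorem mainTheorem7 (θ : ℕ → ℝ) (hθ : ∀ m : ℕ, 1 ≤ m → 0 ≤ θ m)
    (r ϑ K : ℝ) (hr : 0 < r) (hϑ : 0 < ϑ)
    (hg : WeightedPerm.GenFunInClassF θ r ϑ K)
    (A : ℕ → Finset ℕ) (hA : ∀ n : ℕ, A n ⊆ Finset.Icc 1 n)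
    (hd : ∀ C : ℝ, Tendsto
      (fun n : ℕ => C * Real.log n -
        (n : ℝ) / (WeightedPerm.maxOrOne (WeightedPerm.forbidden n (A n)) : ℝ))
      atTop atBot) :
    WeightedPerm.StrongModPoisson
      (fun n : ℕ => WeightedPerm.weightedMeasure θ n (A n))
      (fun (n : ℕ) (σ : Equiv.Perm (Fin n)) => (WeightedPerm.totalCycles σ : ℝ))
      (fun n : ℕ => K + ϑ * Real.log n -
        WeightedPerm.L θ (WeightedPerm.forbidden n (A n)) r)
      (fun s : ℝ => Complex.Gamma ϑ /
        Complex.Gamma (ϑ * Complex.exp (Complex.I * s))) := by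
  have hlam := tendsto_parameter_atTop hθ hr hϑ hg hd
  have hX := tendstoUniformly_normGen hθ hr hϑ hg hd
  set lam : ℕ → ℝ := fun n => K + ϑ * Real.log n - L θ (forbidden n (A n)) r
  have hΓ : Complex.Gamma ϑ ≠ 0 := Complex.Gamma_ne_zero_of_re_pos (by simpa using hϑ)
  have hx : Tendsto (fun n => normGen θ r (lam n) n (A n) 0) atTop (𝓝 (1 / Complex.Gamma ϑ)) := by
    simpa using hX.tendsto_at 0
  have hx0 : ∀ n, normGen θ r (lam n) n (A n) 0 =
      (r : ℂ) ^ n * h θ n (A n) * n * Complex.exp (-(lam n)) := by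
    intro n
    simp [normGen, cycleGen_one]
  -- At s = 0 the limit 1/Γ(ϑ) is nonzero, which forces h_n ≠ 0 for large n.
  have hpos : ∀ᶠ n in atTop, 0 < h θ n (A n) := by
    filter_upwards [hx.eventually_ne (one_div_ne_zero hΓ)] with n hn
    refine (h_nonneg hθ n (A n)).lt_of_ne' fun h0 => hn ?_
    rw [hx0, h0]
    simp
  refine ⟨?_, ?_, hlam.eventually_gt_atTop 0, ?_⟩
  · filter_upwards [hpos] with n hn
    exact isProbabilityMeasure_weightedMeasure hθ hn
  · exact Eventually.of_forall fun n => Measurable.aemeasurable fun s _ => trivial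
  -- In the quotient by the value at s = 0 the factors r^n n cancel, and e^{-wλ}/e^{-λ} is the
  -- required e^{λ(1 - w)}.
  · have h1 : TendstoLocallyUniformly
        (fun (n : ℕ) (s : ℝ) => normGen θ r (lam n) n (A n) s *
          (normGen θ r (lam n) n (A n) 0)⁻¹)
        (fun s : ℝ => 1 / Complex.Gamma (ϑ * Complex.exp (Complex.I * s)) *
          (1 / Complex.Gamma ϑ)⁻¹) atTop := by
      refine hX.tendstoLocallyUniformly.fun_mul₀
        (G := fun n (_ : ℝ) => (normGen θ r (lam n) n (A n) 0)⁻¹)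
        (g := fun _ => (1 / Complex.Gamma ϑ)⁻¹) ?_ (continuous_one_div_Gamma ϑ)
        continuous_const
      exact (hx.inv₀ (one_div_ne_zero hΓ)).tendstoUniformly_const.tendstoLocallyUniformly
    have h2 : (fun s : ℝ => 1 / Complex.Gamma (ϑ * Complex.exp (Complex.I * s)) *
          (1 / Complex.Gamma ϑ)⁻¹) =
        fun s : ℝ => Complex.Gamma ϑ / Complex.Gamma (ϑ * Complex.exp (Complex.I * s)) := by
      funext s
      rw [one_div, one_div, inv_inv, mul_comm, div_eq_mul_inv]
    rw [h2] at h1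
    refine h1.congr_inseparable ?_
    filter_upwards [hpos, eventually_ge_atTop 1] with n hn hn1 s
    refine .of_eq ?_
    have hr0 : (r : ℂ) ≠ 0 := by exact_mod_cast hr.ne'
    have hn0 : (n : ℂ) ≠ 0 := by exact_mod_cast (by omega : n ≠ 0)
    have hh : (h θ n (A n) : ℂ) ≠ 0 := by exact_mod_cast hn.ne'
    have hexp : Complex.exp ((lam n : ℂ) * (1 - Complex.exp (Complex.I * s))) =
        Complex.exp (-(Complex.exp (Complex.I * s) * lam n)) * (Complex.exp (-(lam n : ℂ)))⁻¹ := by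
      rw [← Complex.exp_neg, ← Complex.exp_add]
      congr 1
      ring
    have he := Complex.exp_ne_zero (-(lam n : ℂ))
    have hint := integral_weightedMeasure hθ hn s
    rw [hint, hx0, normGen]
    refine Eq.trans ?_ (congrArg (· * _) hexp).symm
    field_simp
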